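/- Theorem 4.5. Let $\sigma=\{\sigma_i\mid i\in I\}$ be a partition of the set of all primes and let $G$ be a finite group. Terminology. A finite group is a $\pi$-group, for a set $\pi$ of primes, if every prime dividing its order lies in $\pi$; it is $\sigma$-primary if it is a $\sigma_i$-group for some $i$, and $\sigma$-nilpotent if it is a direct product of $\sigma$-primary groups. The $\sigma$-nilpotent residual $G^{\mathfrak N_\sigma}$ is the intersection of all normal subgroups $N$ of $G$ with $G/N$ $\sigma$-nilpotent. A subgroup $A$ of $G$ is $\sigma$-subnormal in $G$ if there is a chain $A=A_0\le A_1\le\dots\le A_n=G$ such that, for each $i=1,\dots,n$, either $A_{i-1}\trianglelefteq A_i$ or $A_i/(A_{i-1})_{A_i}$ is $\sigma$-primary, where $(A_{i-1})_{A_i}$ is the largest normal subgroup of $A_i$ contained in $A_{i-1}$. A subgroup $A$ of $G$ is modular in $G$ if $\langle X,A\cap Z\rangle=\langle X,A\rangle\cap Z$ for all $X\le Z\le G$, and $\langle A,Y\cap Z\rangle=\langle A,Y\rangle\cap Z$ for all $Y,Z\le G$ with $A\le Z$. A subgroup is $\sigma$-quasinormal in $G$ if it is $\sigma$-subnormal and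 modular in $G$. The group $G$ is an $M\sigma T$-group if, whenever $H$ is $\sigma$-quasinormal in $K$ and $K$ is $\sigma$-quasinormal in $G$, $H$ is $\sigma$-quasinormal in $G$. For a group $D$, $O_{\sigma_i}(D)$ is the largest normal $\sigma_i$-subgroup of $D$. A subgroup of $G$ is a Hall subgroup if its order and index are coprime, and a Hall $\sigma_i$-subgroup if it is a $\sigma_i$-group whose index is divisible by no prime in $\sigma_i$. A power automorphism of a group is an automorphism mapping every subgroup onto itself. For subgroups $D$ and $M$ of $G$ consider the following conditions: (i) $G=D\rtimes M$ (that is, $D\trianglelefteq G$, $G=DM$ and $D\cap M=1$), where $D$ is an abelian Hall subgroup of $G$ of odd order, $M$ is $\sigma$-nilpotent and the lattice of all subgroups of $M$ is modular; (ii) every element of $G$ induces by conjugation a power automorphism on $D$; (iii) for every $i\in I$, $O_{\sigma_i}(D)$ has a normal complement in a Hall $\sigma_i$-subgroup of $G$. If $G$ is a soluble $M\sigma T$-group and $D=G^{\mathfrak N_\sigma}$, then there is a subgroup $M$ of $G$ such that (i), (ii) and (iii) hold for $D$ and $M$. Conversely, if (i), (ii) and (iii) hold for some subgroups $D$ and $M$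 of $G$, then $G$ is a soluble $M\sigma T$-group. -/

import Mathlib

namespace SigmaGroup

/-- `σ = {σ i | i ∈ ι}` is a partition of the set of all primes. -/
def IsPrimePartition {ι : Type*} (σ : ι → Set ℕ) : Prop :=
  (⋃ i, σ i) = {p : ℕ | p.Prime} ∧ ∀ i j, i ≠ j → σ i ∩ σ j = ∅

/-- `G` is a `π`-group: every prime divisor of its order lies in `π` (used for finite `G`). -/
def IsPiGroup (π : Set ℕ) (G : Type*) [Group G] : Prop :=
  ∀ p : ℕ, p.Prime → p ∣ Nat.card G → p ∈ π

/-- `H` is a Hall subgroup of `G`: its order and its index are coprime. -/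
def IsHallSubgroup {G : Type*} [Group G] (H : Subgroup G) : Prop :=
  (Nat.card H).Coprime H.index

/-- `H` is a Hall `π`-subgroup of `G`: it is a `π`-group and no prime in `π` divides its index. -/
def IsHallPiSubgroup {G : Type*} [Group G] (π : Set ℕ) (H : Subgroup G) : Prop :=
  IsPiGroup π H ∧ ∀ p : ℕ, p.Prime → p ∣ H.index → p ∉ π

/-- `O_π(G)`: the subgroup generated by all normal `π`-subgroups of `G`
(for finite `G` this is the largest normal `π`-subgroup). -/
def piCore (π : Set ℕ) (G : Type*) [Group G] : Subgroup G :=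
  sSup {N : Subgroup G | N.Normal ∧ IsPiGroup π N}

/-- `G` is `σ`-primary: it is a `σ i`-group for some `i`. -/
def IsSigmaPrimary {ι : Type*} (σ : ι → Set ℕ) (G : Type*) [Group G] : Prop :=
  ∃ i, IsPiGroup (σ i) G

/-- `G` is `σ`-nilpotent: it is the (internal) direct product of finitely many
`σ`-primary subgroups. -/
def IsSigmaNilpotent {ι : Type*} (σ : ι → Set ℕ) (G : Type*) [Group G] : Prop :=
  ∃ (n : ℕ) (K : Fin n → Subgroup G),
    (∀ j, (K j).Normal) ∧ (∀ j, IsSigmaPrimary σ (K j)) ∧ iSupIndep K ∧ ⨆ j, K j = ⊤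

/-- The `σ`-nilpotent residual of `G`: the intersection of all normal subgroups `N` such that
`G ⧸ N` is `σ`-nilpotent. -/
def sigmaResidual {ι : Type*} (σ : ι → Set ℕ) (G : Type*) [Group G] : Subgroup G :=
  sInf {N : Subgroup G | ∃ _ : N.Normal, IsSigmaNilpotent σ (G ⧸ N)}

/-- One link `A ≤ B` of a `σ`-subnormal chain: `A` is normal in `B`, or the quotient of `B` by
the core of `A` in `B` is `σ`-primary. -/
def SigmaSubnormalStep {ι : Type*} (σ : ι → Set ℕ) {G : Type*} [Group G]
    (A B : Subgroup G) : Prop :=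
  A ≤ B ∧ ((A.subgroupOf B).Normal ∨ IsSigmaPrimary σ (B ⧸ (A.subgroupOf B).normalCore))

/-- `A` is `σ`-subnormal in `G`: a finite chain of such links leads from `A` to `G`. -/
def IsSigmaSubnormal {ι : Type*} (σ : ι → Set ℕ) {G : Type*} [Group G]
    (A : Subgroup G) : Prop :=
  Relation.ReflTransGen (SigmaSubnormalStep σ) A ⊤

/-- `M` is modular in `G`: it is a modular element, in the sense of Kurosh, of the lattice of
all subgroups of `G`. -/
def IsModularSubgroup {G : Type*} [Group G] (M : Subgroup G) : Prop :=
  (∀ X Z : Subgroup G, X ≤ Z → X ⊔ (M ⊓ Z) = (X ⊔ M) ⊓ Z) ∧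
  (∀ Y Z : Subgroup G, M ≤ Z → M ⊔ (Y ⊓ Z) = (M ⊔ Y) ⊓ Z)

/-- `A` is `σ`-quasinormal in `G`: it is `σ`-subnormal and modular in `G`. -/
def IsSigmaQuasinormal {ι : Type*} (σ : ι → Set ℕ) {G : Type*} [Group G]
    (A : Subgroup G) : Prop :=
  IsSigmaSubnormal σ A ∧ IsModularSubgroup A

/-- `G` is an `MσT`-group: if `K` is `σ`-quasinormal in `G` and `H` is `σ`-quasinormal in `K`,
then `H` is `σ`-quasinormal in `G`. -/
def IsMSigmaTGroup {ι : Type*} (σ : ι → Set ℕ) (G : Type*) [Group G] : Prop :=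
  ∀ (K : Subgroup G) (H : Subgroup K),
    IsSigmaQuasinormal σ H → IsSigmaQuasinormal σ K → IsSigmaQuasinormal σ (H.map K.subtype)

/-- A power automorphism: an automorphism that maps every subgroup onto itself. -/
def IsPowerAutomorphism {D : Type*} [Group D] (φ : MulAut D) : Prop :=
  ∀ H : Subgroup D, H.map φ.toMonoidHom = H

/-- `A` has a normal complement in the subgroup `H` of `G` (where `A ≤ H`). -/
def HasNormalComplementIn {G : Type*} [Group G] (A H : Subgroup G) : Prop :=
  A ≤ H ∧ ∃ S : Subgroup H, S.Normal ∧ (A.subgroupOf H).IsComplement' S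

/-- The structural conditions on a pair `D`, `M` of subgroups of `G`. -/
structure StructureConditions {ι : Type*} (σ : ι → Set ℕ) {G : Type*} [Group G]
    (D M : Subgroup G) : Prop where
  /-- `G = D ⋊ M` -/
  normal : D.Normal
  compl : D.IsComplement' M
  abelian : IsMulCommutative D
  hall : IsHallSubgroup D
  odd : Odd (Nat.card D)
  nilpotent : IsSigmaNilpotent σ M
  modular : IsModularLattice (Subgroup M)
  /-- every element of `G` induces by conjugation a power automorphism on `D` -/
  power : ∀ g : G, IsPowerAutomorphism (MulAut.conjNormal g : MulAut D)
  /-- `O_{σ i}(D)` has a normal complement in a Hall `σ i`-subgroup of `G`, for every `i` -/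
  complement : ∀ i, ∃ H : Subgroup G, IsHallPiSubgroup (σ i) H ∧
    HasNormalComplementIn ((piCore (σ i) D).map D.subtype) H

end SigmaGroup

/-! Everything is tested on elements of prime power order. A finite group is σ-nilpotent exactly
when elements of prime power order belonging to different blocks commute (`isSigmaNilpotent_iff`),
so the residual is the least normal subgroup containing all commutators of such pairs. σ-subnormal
links are rephrased in the same way.

Sufficiency. Let A be σ-subnormal and E = A ∩ D. Conjugation acts on D by power automorphisms, so E
is normal in G and may be factored out. Climbing the chain from A to G shows that each p-element of
A with p not dividing |D| centralises D modulo E (`commute_mod_of_chain`); condition (iii) handles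
links whose block contains both primes involved. Hence A/E has order prime to |D| and centralises
D/E, and such a subgroup is modular because G/D, an image of M, has a modular subgroup lattice
(`isModularSubgroup_of_centralizing`). Thus every σ-subnormal subgroup is modular, and
σ-subnormality is transitive. Solubility of G reduces to that of M: in a finite group with modular
lattice the elements of order the largest prime divisor generate an abelian normal subgroup.

Necessity. In an MσT-group every subgroup of a normal p-subgroup is σ-quasinormal and hence
normalised by all p'-elements. So p'-elements induce power automorphisms on normal p-subgroups, and
a nontrivial power automorphism of order prime to p forces the p-group to be abelian and fixes only
the identity. In a soluble MσT-group the Sylow subgroup P for the largest prime p is normal. Induct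
through G/P. Let σ_i be the block of p. If all σ_i'-elements centralise P, then D ∩ P = 1 and the
properties of D lift from G/P. Otherwise P is abelian, all its subgroups are normal in G, and P ≤ D;
the remaining point is that σ_i-elements centralise P (`IsMSigmaTGroup.commute_of_block`). A failure
makes P a self-centralising subgroup of prime order contained in every nontrivial normal subgroup,
and modularity of a suitable subgroup of prime order contradicts the presence of a second block.

Finally Schur–Zassenhaus gives M, isomorphic to the σ-nilpotent group G/D. In G/D every subgroup is
σ-subnormal, so modularity is transitive there, and a soluble group with transitive modularity has a
modular lattice (`ModularTransitive.isModularLattice`). -/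

namespace SigmaGroup

open scoped commutatorElement

/-! ### Elements of prime power order -/

section Elements

variable {G : Type*} [Group G] {G' : Type*} [Group G']

/-- `x` is a `p`-element: its order divides a power of `p`. -/
def IsPElement (p : ℕ) (x : G) : Prop := ∃ k : ℕ, x ^ p ^ k = 1

theorem IsPElement.map {p : ℕ} {x : G} (h : IsPElement p x) (f : G →* G') :
    IsPElement p (f x) := by
  obtain ⟨k, hk⟩ := h
  exact ⟨k, by rw [← map_pow, hk, map_one]⟩

theorem IsPElement.of_map {p : ℕ} {x : G} (f : G →* G') (hf : Function.Injective f)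
    (h : IsPElement p (f x)) : IsPElement p x := by
  obtain ⟨k, hk⟩ := h
  exact ⟨k, hf (by rw [map_pow, hk, map_one])⟩

theorem IsPElement.zpow {p : ℕ} {x : G} (h : IsPElement p x) (n : ℤ) : IsPElement p (x ^ n) := by
  obtain ⟨k, hk⟩ := h
  refine ⟨k, ?_⟩
  rw [← zpow_natCast, ← zpow_mul, mul_comm, zpow_mul, zpow_natCast, hk, one_zpow]

theorem IsPElement.inv {p : ℕ} {x : G} (h : IsPElement p x) : IsPElement p x⁻¹ := by
  simpa using h.zpow (-1)

theorem IsPElement.mem_zpowers {p : ℕ} {x y : G} (h : IsPElement p x)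
    (hy : y ∈ Subgroup.zpowers x) : IsPElement p y := by
  obtain ⟨n, rfl⟩ := hy
  exact h.zpow n

theorem IsPElement.conj {p : ℕ} {x : G} (h : IsPElement p x) (g : G) :
    IsPElement p (g * x * g⁻¹) := by
  simpa using h.map (MulAut.conj g).toMonoidHom

theorem mem_of_pow_mem {H : Subgroup G} {x : G} {m n : ℕ} (hn : x ^ n = 1)
    (hc : m.Coprime n) (hm : x ^ m ∈ H) : x ∈ H := by
  have h1 : x = (x ^ m) ^ (m.gcdA n) := by
    have h := Nat.gcd_eq_gcd_ab m n
    rw [hc.gcd_eq_one] at h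
    calc x = x ^ (((1 : ℕ) : ℤ)) := by simp
      _ = (x ^ m) ^ (m.gcdA n) * (x ^ n) ^ (m.gcdB n) := by
        rw [h, zpow_add, zpow_mul, zpow_mul, zpow_natCast, zpow_natCast]
      _ = _ := by rw [hn]; simp
  rw [h1]
  exact H.zpow_mem hm _

theorem eq_one_of_pow_eq_one_of_coprime {x : G} {m n : ℕ} (hn : x ^ n = 1) (hc : m.Coprime n)
    (hm : x ^ m = 1) : x = 1 := by
  rw [← Subgroup.mem_bot]
  exact mem_of_pow_mem hn hc (by simpa using hm)

theorem IsPElement.mem_of_index {p : ℕ} (hp : p.Prime) {x : G} (hx : IsPElement p x)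
    (N : Subgroup G) [N.Normal] (hN : ¬ p ∣ N.index) : x ∈ N := by
  obtain ⟨k, hk⟩ := hx
  exact mem_of_pow_mem hk (((Nat.Prime.coprime_iff_not_dvd hp).2 hN).symm.pow_right k)
    (N.pow_index_mem x)

theorem IsPElement.eq_one_of_not_dvd {p : ℕ} (hp : p.Prime) {x : G} (hx : IsPElement p x)
    {H : Subgroup G} (hxH : x ∈ H) (hH : ¬ p ∣ Nat.card H) : x = 1 := by
  obtain ⟨k, hk⟩ := hx
  have h1 : x ^ Nat.card H = 1 := by
    exact congrArg Subtype.val (pow_card_eq_one' (x := (⟨x, hxH⟩ : H)))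
  exact eq_one_of_pow_eq_one_of_coprime hk
    (((Nat.Prime.coprime_iff_not_dvd hp).2 hH).symm.pow_right k) h1

theorem IsPElement.eq_one_of_ne {p q : ℕ} (hp : p.Prime) (hq : q.Prime) (hpq : p ≠ q) {x : G}
    (hx : IsPElement p x) (hy : IsPElement q x) : x = 1 := by
  obtain ⟨k, hk⟩ := hx
  obtain ⟨l, hl⟩ := hy
  exact eq_one_of_pow_eq_one_of_coprime hk
    (Nat.Coprime.pow _ _ ((Nat.coprime_primes hq hp).2 hpq.symm)) hl

theorem IsPElement.dvd_card [Finite G] {p : ℕ} (hp : p.Prime) {x : G} (hx : IsPElement p x)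
    (h1 : x ≠ 1) {H : Subgroup G} (hxH : x ∈ H) : p ∣ Nat.card H := by
  by_contra h
  exact h1 (hx.eq_one_of_not_dvd hp hxH h)

/-- An element of a finite group lies in `H` as soon as all its powers of prime power order do. -/
theorem mem_of_forall_isPElement [Finite G] {H : Subgroup G} {x : G}
    (h : ∀ p : ℕ, p.Prime → ∀ y ∈ Subgroup.zpowers x, IsPElement p y → y ∈ H) : x ∈ H := by
  have key : ∀ n : ℕ, 0 < n → ∀ y ∈ Subgroup.zpowers x, y ^ n = 1 → y ∈ H := by
    intro n
    induction n using Nat.recOnPrimeCoprime with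
    | zero => intro h0; exact absurd h0 (lt_irrefl _)
    | prime_pow p k hp => intro _ y hy hk; exact h p hp y hy ⟨k, hk⟩
    | coprime a b ha hb hab iha ihb =>
      intro _ y hy hyn
      have h1 : y ^ a ∈ H :=
        ihb (by omega) _ (Subgroup.pow_mem _ hy _) (by rw [← pow_mul, hyn])
      have h2 : y ^ b ∈ H :=
        iha (by omega) _ (Subgroup.pow_mem _ hy _) (by rw [← pow_mul, mul_comm, hyn])
      have h := Nat.gcd_eq_gcd_ab a b
      rw [hab.gcd_eq_one] at h
      have h3 : y = (y ^ a) ^ (a.gcdA b) * (y ^ b) ^ (a.gcdB b) := by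
        rw [← zpow_natCast, ← zpow_natCast, ← zpow_mul, ← zpow_mul, ← zpow_add, ← h]; simp
      rw [h3]
      exact H.mul_mem (H.zpow_mem h1 _) (H.zpow_mem h2 _)
  exact key (orderOf x) (orderOf_pos x) x (Subgroup.mem_zpowers x) (pow_orderOf_eq_one x)

theorem le_of_forall_isPElement [Finite G] {H K : Subgroup G}
    (h : ∀ p : ℕ, p.Prime → ∀ y ∈ K, IsPElement p y → y ∈ H) : K ≤ H := fun _ hx =>
  mem_of_forall_isPElement fun p hp y hy hpy =>
    h p hp y ((Subgroup.zpowers_le.2 hx) hy) hpy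

theorem not_dvd_index_of_forall_isPElement [Finite G] {p : ℕ} (hp : p.Prime) {H : Subgroup G}
    (h : ∀ x : G, IsPElement p x → x ∈ H) : ¬ p ∣ H.index := by
  have := Fact.mk hp
  obtain ⟨P⟩ : Nonempty (Sylow p G) := inferInstance
  have hle : (P : Subgroup G) ≤ H := by
    intro x hx
    obtain ⟨k, hk⟩ := P.isPGroup' ⟨x, hx⟩
    exact h x ⟨k, by simpa [Subtype.ext_iff] using hk⟩
  exact fun hd => P.not_dvd_index (hd.trans (Subgroup.index_dvd_of_le hle))

/-- The p-part of any preimage works: a Bézout multiple of the p'-part m of its order, congruent to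
1 modulo the order of y, is the exponent that extracts it. -/
theorem exists_isPElement_lift [Finite G] {f : G →* G'} (hf : Function.Surjective f) {p : ℕ}
    (hp : p.Prime) {y : G'} (hy : IsPElement p y) : ∃ x : G, IsPElement p x ∧ f x = y := by
  obtain ⟨x, rfl⟩ := hf y
  obtain ⟨k, hk⟩ := hy
  obtain ⟨e, m, hm, hn⟩ := Nat.exists_eq_pow_mul_and_not_dvd (orderOf_pos x).ne' p hp.ne_one
  have hc : m.Coprime (p ^ k) := ((Nat.Prime.coprime_iff_not_dvd hp).2 hm).symm.pow_right k
  have h := Nat.gcd_eq_gcd_ab m (p ^ k)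
  rw [hc.gcd_eq_one] at h
  refine ⟨(x ^ m) ^ (m.gcdA (p ^ k)), IsPElement.zpow ⟨e, ?_⟩ _, ?_⟩
  · rw [← pow_mul, mul_comm, ← hn, pow_orderOf_eq_one]
  · rw [map_zpow, map_pow]
    calc _ = (f x ^ m) ^ (m.gcdA (p ^ k)) * (f x ^ p ^ k) ^ (m.gcdB (p ^ k)) := by rw [hk]; simp
      _ = f x ^ (((1 : ℕ) : ℤ)) := by
        rw [h, zpow_add, zpow_mul, zpow_mul, zpow_natCast, zpow_natCast]
      _ = f x := by simp

theorem isPElement_of_isPGroup {p : ℕ} {H : Subgroup G} (hH : IsPGroup p H) {x : G}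
    (hx : x ∈ H) : IsPElement p x := by
  obtain ⟨k, hk⟩ := hH ⟨x, hx⟩
  exact ⟨k, by simpa [Subtype.ext_iff] using hk⟩

theorem isPGroup_of_isPElement {p : ℕ} {H : Subgroup G} (h : ∀ x ∈ H, IsPElement p x) :
    IsPGroup p H := by
  rintro ⟨x, hx⟩
  obtain ⟨k, hk⟩ := h x hx
  exact ⟨k, by simpa [Subtype.ext_iff] using hk⟩

/-- If `x * c` and `x` are `p`-elements, `c` commutes with `x` and has order prime to `p`,
then `c = 1`. -/
theorem IsPElement.eq_one_of_commute {p n : ℕ} {x c : G} (hx : IsPElement p x)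
    (hxc : IsPElement p (x * c)) (hcomm : Commute x c) (hn : c ^ n = 1) (hc : n.Coprime p) :
    c = 1 := by
  obtain ⟨k, hk⟩ := hx
  obtain ⟨l, hl⟩ := hxc
  have h1 : c ^ p ^ (k + l) = 1 := by
    have h2 : (x * c) ^ p ^ (k + l) = 1 := by rw [add_comm, pow_add, pow_mul, hl, one_pow]
    rw [hcomm.mul_pow, pow_add, pow_mul x, hk, one_pow, one_mul] at h2
    rw [pow_add]; exact h2
  exact eq_one_of_pow_eq_one_of_coprime h1 (hc.pow_right _) hn

end Elements

/-! ### Modular subgroups -/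

section Modular

variable {G : Type*} [Group G] {G' : Type*} [Group G']

theorem IsModularSubgroup.of_map {f : G →* G'} (hf : Function.Injective f) {A : Subgroup G}
    (h : IsModularSubgroup (A.map f)) : IsModularSubgroup A := by
  constructor
  · intro X Z hXZ
    apply Subgroup.map_injective hf
    simpa [Subgroup.map_sup, Subgroup.map_inf_eq _ _ f hf] using
      h.1 (X.map f) (Z.map f) (Subgroup.map_mono hXZ)
  · intro Y Z hAZ
    apply Subgroup.map_injective hf
    simpa [Subgroup.map_sup, Subgroup.map_inf_eq _ _ f hf] using
      h.2 (Y.map f) (Z.map f) (Subgroup.map_mono hAZ)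

theorem sup_inf_of_normal {N : Subgroup G} [N.Normal] {A Z : Subgroup G} (h : A ≤ Z) :
    (A ⊔ N) ⊓ Z = A ⊔ (N ⊓ Z) := by
  apply le_antisymm
  · rintro x ⟨hx, hxZ⟩
    obtain ⟨a, ha, n, hn, rfl⟩ := Subgroup.mem_sup_of_normal_right.1 hx
    refine Subgroup.mul_mem_sup ha ⟨hn, ?_⟩
    have := Z.mul_mem (Z.inv_mem (h ha)) hxZ
    simpa using this
  · exact le_inf (sup_le le_sup_left (inf_le_left.trans le_sup_right)) (sup_le h inf_le_right)

theorem sup_inf_of_normal' {N : Subgroup G} [N.Normal] {Y Z : Subgroup G} (h : N ≤ Z) :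
    (Y ⊔ N) ⊓ Z = (Y ⊓ Z) ⊔ N := by
  apply le_antisymm
  · rintro x ⟨hx, hxZ⟩
    obtain ⟨a, ha, n, hn, rfl⟩ := Subgroup.mem_sup_of_normal_right.1 hx
    refine Subgroup.mul_mem_sup ⟨ha, ?_⟩ hn
    have := Z.mul_mem hxZ (Z.inv_mem (h hn))
    simpa using this
  · exact le_inf (sup_le_sup_right inf_le_left _) (sup_le inf_le_right h)

theorem isModularSubgroup_of_normal (N : Subgroup G) [N.Normal] : IsModularSubgroup N := by
  constructor
  · intro X Z h
    exact (sup_inf_of_normal h).symm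
  · intro Y Z h
    rw [sup_comm N (Y ⊓ Z), sup_comm N Y]
    exact (sup_inf_of_normal' h).symm

/-- Descent is injectivity of `comap`. For the ascent X and Z need not contain the kernel: the law
holds for their images, and since the kernel lies in the preimage of A, Dedekind's law for the
kernel cuts the result back to Z. -/
theorem isModularSubgroup_comap_iff {f : G →* G'} (hf : Function.Surjective f)
    {A : Subgroup G'} : IsModularSubgroup (A.comap f) ↔ IsModularSubgroup A := by
  constructor
  · intro h
    constructor
    · intro X Z hXZ
      apply Subgroup.comap_injective hf
      simpa [← Subgroup.comap_sup_eq f _ _ hf, Subgroup.comap_inf] using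
        h.1 (X.comap f) (Z.comap f) (Subgroup.comap_mono hXZ)
    · intro Y Z hAZ
      apply Subgroup.comap_injective hf
      simpa [← Subgroup.comap_sup_eq f _ _ hf, Subgroup.comap_inf] using
        h.2 (Y.comap f) (Z.comap f) (Subgroup.comap_mono hAZ)
  · intro h
    have hker : f.ker ≤ A.comap f := Subgroup.ker_le_comap f A
    have hcm : ∀ X : Subgroup G, (X.map f).comap f = X ⊔ f.ker := fun X =>
      Subgroup.comap_map_eq f X
    constructor
    · intro X Z hXZ
      apply le_antisymm
      · exact le_inf (sup_le le_sup_left (inf_le_left.trans le_sup_right))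
          (sup_le hXZ inf_le_right)
      · have h1 := h.1 (X.map f) (Z.map f) (Subgroup.map_mono hXZ)
        have h2 := congrArg (Subgroup.comap f) h1
        rw [← Subgroup.comap_sup_eq f _ _ hf, Subgroup.comap_inf, Subgroup.comap_inf,
          ← Subgroup.comap_sup_eq f _ _ hf, hcm, hcm] at h2
        have h3 : A.comap f ⊓ (Z ⊔ f.ker) = (A.comap f ⊓ Z) ⊔ f.ker := by
          rw [inf_comm, sup_inf_of_normal' hker, inf_comm]
        rw [h3] at h2
        have h4 : (X ⊔ A.comap f) ⊓ Z ≤ (X ⊔ f.ker ⊔ (A.comap f ⊓ Z ⊔ f.ker)) ⊓ Z := by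
          rw [h2]
          exact le_inf (inf_le_inf (sup_le_sup_right le_sup_left _) le_sup_left) inf_le_right
        refine h4.trans ?_
        have h5 : X ⊔ f.ker ⊔ (A.comap f ⊓ Z ⊔ f.ker) = (X ⊔ A.comap f ⊓ Z) ⊔ f.ker := by
          apply le_antisymm
          · exact sup_le (sup_le (le_sup_left.trans le_sup_left) le_sup_right)
              (sup_le (le_sup_right.trans le_sup_left) le_sup_right)
          · exact sup_le (sup_le (le_sup_left.trans le_sup_left)
              (le_sup_left.trans le_sup_right)) (le_sup_right.trans le_sup_left)
        rw [h5, sup_inf_of_normal (sup_le hXZ inf_le_right)]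
        exact sup_le le_rfl (le_sup_right.trans' (inf_le_inf_right _ hker))
    · intro Y Z hAZ
      have hkZ : f.ker ≤ Z := hker.trans hAZ
      have h1 := h.2 (Y.map f) (Z.map f) (by
        rw [← Subgroup.map_comap_eq_self_of_surjective hf A]; exact Subgroup.map_mono hAZ)
      have h2 := congrArg (Subgroup.comap f) h1
      rw [← Subgroup.comap_sup_eq f _ _ hf, Subgroup.comap_inf, Subgroup.comap_inf,
        ← Subgroup.comap_sup_eq f _ _ hf, hcm, hcm, sup_eq_left.2 hkZ,
        sup_inf_of_normal' hkZ] at h2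
      have h3 : A.comap f ⊔ (Y ⊓ Z ⊔ f.ker) = A.comap f ⊔ (Y ⊓ Z) := by
        rw [sup_comm (Y ⊓ Z), ← sup_assoc, sup_eq_left.2 hker]
      have h4 : A.comap f ⊔ (Y ⊔ f.ker) = A.comap f ⊔ Y := by
        rw [sup_comm Y, ← sup_assoc, sup_eq_left.2 hker]
      rwa [h3, h4] at h2

theorem isModularLattice_iff :
    IsModularLattice (Subgroup G) ↔ ∀ A : Subgroup G, IsModularSubgroup A := by
  constructor
  · intro h A
    exact ⟨fun X Z hXZ => (sup_inf_assoc_of_le A hXZ).symm,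
      fun Y Z hAZ => (sup_inf_assoc_of_le Y hAZ).symm⟩
  · intro h
    exact ⟨fun {X} Y Z hXZ => ((h Y).1 X Z hXZ).ge⟩

theorem isModularLattice_of_surjective (h : IsModularLattice (Subgroup G)) {f : G →* G'}
    (hf : Function.Surjective f) : IsModularLattice (Subgroup G') :=
  isModularLattice_iff.2 fun A =>
    (isModularSubgroup_comap_iff hf).1 (isModularLattice_iff.1 h (A.comap f))

theorem isModularLattice_of_injective (h : IsModularLattice (Subgroup G')) {f : G →* G'}
    (hf : Function.Injective f) : IsModularLattice (Subgroup G) :=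
  isModularLattice_iff.2 fun A => .of_map hf (isModularLattice_iff.1 h (A.map f))

end Modular

/-! ### `σ`-subnormal and `σ`-quasinormal subgroups -/

section Subnormal

variable {ι : Type*} {σ : ι → Set ℕ} {G : Type*} [Group G] {G' : Type*} [Group G']

theorem isPiGroup_subgroup_iff [Finite G] {π : Set ℕ} {H : Subgroup G} :
    IsPiGroup π H ↔ ∀ q : ℕ, q.Prime → q ∉ π → ∀ x ∈ H, IsPElement q x → x = 1 := by
  constructor
  · intro h q hq hqπ x hx hxq
    exact hxq.eq_one_of_not_dvd hq hx fun hd => hqπ (h q hq hd)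
  · intro h p hp hd
    by_contra hpπ
    have := Fact.mk hp
    obtain ⟨x, hx⟩ := exists_prime_orderOf_dvd_card' p hd
    have h1 : (x : G) = 1 := h p hp hpπ x x.2 ⟨1, by
      rw [pow_one, ← hx]; exact congrArg Subtype.val (pow_orderOf_eq_one x)⟩
    rw [Subtype.ext (a1 := x) (a2 := 1) h1, orderOf_one] at hx
    exact hp.ne_one hx.symm

theorem isPiGroup_quotient_iff [Finite G] {π : Set ℕ} {N : Subgroup G} [N.Normal] :
    IsPiGroup π (G ⧸ N) ↔ ∀ q : ℕ, q.Prime → q ∉ π → ∀ x : G, IsPElement q x → x ∈ N := by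
  have hc : Nat.card (G ⧸ N) = N.index := rfl
  constructor
  · intro h q hq hqπ x hx
    exact hx.mem_of_index hq N fun hd => hqπ (h q hq (hc ▸ hd))
  · intro h p hp hd
    by_contra hpπ
    exact not_dvd_index_of_forall_isPElement hp (h p hp hpπ) (hc ▸ hd)

/-- A form without quotients or subtypes: the quotient by the core is a σ_i-group exactly when some
B-invariant N ≤ A contains every q-element of B with q outside σ_i. It passes easily to images and
preimages. -/
theorem sigmaSubnormalStep_iff [Finite G] {A B : Subgroup G} :
    SigmaSubnormalStep σ A B ↔ A ≤ B ∧ ((∀ a ∈ A, ∀ b ∈ B, b * a * b⁻¹ ∈ A) ∨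
      ∃ i, ∃ N ≤ A, (∀ n ∈ N, ∀ b ∈ B, b * n * b⁻¹ ∈ N) ∧
        ∀ q : ℕ, q.Prime → q ∉ σ i → ∀ x ∈ B, IsPElement q x → x ∈ N) := by
  unfold SigmaSubnormalStep
  refine and_congr_right fun hAB => or_congr ?_ ?_
  · rw [Subgroup.normal_subgroupOf_iff hAB]
    exact ⟨fun h a ha b hb => h a b ha hb, fun h a b ha hb => h a ha b hb⟩
  · unfold IsSigmaPrimary
    refine exists_congr fun i => ?_
    rw [isPiGroup_quotient_iff]
    constructor
    · intro h
      refine ⟨((A.subgroupOf B).normalCore).map B.subtype, ?_, ?_, ?_⟩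
      · rw [Subgroup.map_le_iff_le_comap]
        exact Subgroup.normalCore_le _
      · rintro _ ⟨n, hn, rfl⟩ b hb
        exact ⟨⟨b, hb⟩ * n * ⟨b, hb⟩⁻¹, Subgroup.Normal.conj_mem inferInstance n hn _, rfl⟩
      · intro q hq hqi x hx hxq
        exact ⟨⟨x, hx⟩, h q hq hqi ⟨x, hx⟩
          (IsPElement.of_map B.subtype B.subtype_injective hxq), rfl⟩
    · rintro ⟨N, hNA, hN, h⟩ q hq hqi x hxq
      have : (N.subgroupOf B).Normal := (Subgroup.normal_subgroupOf_iff (hNA.trans hAB)).2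
        fun n b hn hb => hN n hn b hb
      have hle : N.subgroupOf B ≤ (A.subgroupOf B).normalCore :=
        Subgroup.normal_le_normalCore.2 (Subgroup.comap_mono hNA)
      exact hle (h q hq hqi x x.2 (hxq.map B.subtype))

theorem SigmaSubnormalStep.comap [Finite G] [Finite G'] (f : G →* G') {A B : Subgroup G'}
    (h : SigmaSubnormalStep σ A B) : SigmaSubnormalStep σ (A.comap f) (B.comap f) := by
  rw [sigmaSubnormalStep_iff] at h ⊢
  refine ⟨Subgroup.comap_mono h.1, h.2.imp (fun h a ha b hb => ?_) ?_⟩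
  · simpa using h _ ha _ hb
  · rintro ⟨i, N, hNA, hN, h⟩
    exact ⟨i, N.comap f, Subgroup.comap_mono hNA, fun n hn b hb => by simpa using hN _ hn _ hb,
      fun q hq hqi x hx hxq => h q hq hqi _ hx (hxq.map f)⟩

theorem SigmaSubnormalStep.map [Finite G] [Finite G'] (f : G →* G') {A B : Subgroup G}
    (h : SigmaSubnormalStep σ A B) : SigmaSubnormalStep σ (A.map f) (B.map f) := by
  rw [sigmaSubnormalStep_iff] at h ⊢
  refine ⟨Subgroup.map_mono h.1, h.2.imp ?_ ?_⟩
  · rintro h _ ⟨a, ha, rfl⟩ _ ⟨b, hb, rfl⟩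
    exact ⟨_, h a ha b hb, by simp⟩
  · rintro ⟨i, N, hNA, hN, h⟩
    refine ⟨i, N.map f, Subgroup.map_mono hNA, ?_, ?_⟩
    · rintro _ ⟨a, ha, rfl⟩ _ ⟨b, hb, rfl⟩
      exact ⟨_, hN a ha b hb, by simp⟩
    · intro q hq hqi y hy hyq
      obtain ⟨x, hxq, hx⟩ := exists_isPElement_lift (f.subgroupMap_surjective B) hq
        (y := ⟨y, hy⟩) (IsPElement.of_map (Subgroup.subtype _) (Subgroup.subtype_injective _) hyq)
      exact ⟨x, h q hq hqi x x.2 (hxq.map B.subtype), congrArg Subtype.val hx⟩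

theorem IsSigmaSubnormal.comap [Finite G] [Finite G'] (f : G →* G') {A : Subgroup G'}
    (h : IsSigmaSubnormal σ A) : IsSigmaSubnormal σ (A.comap f) := by
  have := Relation.ReflTransGen.lift (p := SigmaSubnormalStep σ) (Subgroup.comap f)
    (fun A B h => SigmaSubnormalStep.comap f h) _ _ h
  rwa [Function.onFun, Subgroup.comap_top] at this

theorem isSigmaSubnormal_comap_iff [Finite G] [Finite G'] {f : G →* G'}
    (hf : Function.Surjective f) {A : Subgroup G'} :
    IsSigmaSubnormal σ (A.comap f) ↔ IsSigmaSubnormal σ A := by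
  refine ⟨fun h => ?_, fun h => h.comap f⟩
  have := Relation.ReflTransGen.lift (p := SigmaSubnormalStep σ) (Subgroup.map f)
    (fun A B h => SigmaSubnormalStep.map f h) _ _ h
  rwa [Function.onFun, Subgroup.map_comap_eq_self_of_surjective hf,
    Subgroup.map_top_of_surjective f hf] at this

theorem IsSigmaSubnormal.trans [Finite G] {K : Subgroup G} {H : Subgroup K}
    (hH : IsSigmaSubnormal σ H) (hK : IsSigmaSubnormal σ K) :
    IsSigmaSubnormal σ (H.map K.subtype) := by
  have := Relation.ReflTransGen.lift (p := SigmaSubnormalStep σ) (Subgroup.map K.subtype)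
    (fun A B h => SigmaSubnormalStep.map _ h) _ _ hH
  rw [Function.onFun, ← MonoidHom.range_eq_map, Subgroup.range_subtype] at this
  exact Relation.ReflTransGen.trans this hK

theorem isSigmaQuasinormal_comap_iff [Finite G] [Finite G'] {f : G →* G'}
    (hf : Function.Surjective f) {A : Subgroup G'} :
    IsSigmaQuasinormal σ (A.comap f) ↔ IsSigmaQuasinormal σ A :=
  and_congr (isSigmaSubnormal_comap_iff hf) (isModularSubgroup_comap_iff hf)

theorem isSigmaQuasinormal_of_normal (N : Subgroup G) [hN : N.Normal] :
    IsSigmaQuasinormal σ N := by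
  refine ⟨Relation.ReflTransGen.single ⟨le_top, Or.inl ?_⟩, isModularSubgroup_of_normal N⟩
  exact Subgroup.Normal.subgroupOf hN _

theorem IsMSigmaTGroup.of_surjective [Finite G] [Finite G'] (h : IsMSigmaTGroup σ G) {f : G →* G'}
    (hf : Function.Surjective f) : IsMSigmaTGroup σ G' := by
  intro K H hH hK
  have hg : Function.Surjective (f.subgroupComap K) := by
    rintro ⟨y, hy⟩
    obtain ⟨x, rfl⟩ := hf y
    exact ⟨⟨x, hy⟩, rfl⟩
  have h1 := h (K.comap f) (H.comap (f.subgroupComap K))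
    ((isSigmaQuasinormal_comap_iff hg).2 hH) ((isSigmaQuasinormal_comap_iff hf).2 hK)
  have h2 : (H.comap (f.subgroupComap K)).map (K.comap f).subtype
      = (H.map K.subtype).comap f := by
    ext x
    constructor
    · rintro ⟨y, hy, rfl⟩
      exact ⟨_, hy, rfl⟩
    · rintro ⟨y, hy, hyx⟩
      have hxK : x ∈ K.comap f := by
        rw [Subgroup.mem_comap, ← hyx]; exact y.2
      refine ⟨⟨x, hxK⟩, ?_, rfl⟩
      have : f.subgroupComap K ⟨x, hxK⟩ = y := Subtype.ext hyx.symm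
      change f.subgroupComap K ⟨x, hxK⟩ ∈ H
      rwa [this]
  rw [h2] at h1
  exact (isSigmaQuasinormal_comap_iff hf).1 h1

theorem IsMSigmaTGroup.trans (h : IsMSigmaTGroup σ G) {A B : Subgroup G} (hAB : A ≤ B)
    (hA : IsSigmaQuasinormal σ (A.subgroupOf B)) (hB : IsSigmaQuasinormal σ B) :
    IsSigmaQuasinormal σ A := by
  have := h B _ hA hB
  rwa [Subgroup.map_subgroupOf_eq_of_le hAB] at this

end Subnormal

/-! ### `σ`-nilpotent groups -/

section Nilpotent

variable {ι : Type*} {σ : ι → Set ℕ} {G : Type*} [Group G] {G' : Type*} [Group G']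

/-- The subgroup generated by all `p`-elements with `p ∈ π`. -/
def piClosure (π : Set ℕ) (G : Type*) [Group G] : Subgroup G :=
  Subgroup.closure {x | ∃ p : ℕ, p.Prime ∧ p ∈ π ∧ IsPElement p x}

theorem IsPElement.mem_piClosure {π : Set ℕ} {p : ℕ} {x : G} (hx : IsPElement p x) (hp : p.Prime)
    (hpπ : p ∈ π) : x ∈ piClosure π G :=
  Subgroup.subset_closure ⟨p, hp, hpπ, hx⟩

instance piClosure_normal (π : Set ℕ) : (piClosure π G).Normal := by
  constructor
  intro n hn g
  have h : piClosure π G ≤ (piClosure π G).comap (MulAut.conj g).toMonoidHom := by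
    refine (Subgroup.closure_le _).2 ?_
    rintro x ⟨p, hp, hpπ, hx⟩
    exact (hx.conj g).mem_piClosure hp hpπ
  exact h hn

/-- Elements of prime power orders that belong to different blocks of `σ` commute. -/
def SigmaCommuting (σ : ι → Set ℕ) (G : Type*) [Group G] : Prop :=
  ∀ i, ∀ p q : ℕ, p.Prime → q.Prime → p ∈ σ i → q ∉ σ i →
    ∀ x y : G, IsPElement p x → IsPElement q y → Commute x y

theorem SigmaCommuting.of_injective (h : SigmaCommuting σ G') {f : G →* G'}
    (hf : Function.Injective f) : SigmaCommuting σ G := by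
  intro i p q hp hq hpi hqi x y hx hy
  apply hf
  rw [map_mul, map_mul]
  exact h i p q hp hq hpi hqi _ _ (hx.map f) (hy.map f)

theorem exists_mem_block (hσ : IsPrimePartition σ) {p : ℕ} (hp : p.Prime) : ∃ i, p ∈ σ i := by
  have : p ∈ ⋃ i, σ i := by rw [hσ.1]; exact hp
  exact Set.mem_iUnion.1 this

theorem block_unique (hσ : IsPrimePartition σ) {p : ℕ} {i j : ι} (hi : p ∈ σ i) (hj : p ∈ σ j) :
    i = j := by
  by_contra h
  have : p ∈ σ i ∩ σ j := ⟨hi, hj⟩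
  rw [hσ.2 i j h] at this
  exact this

theorem IsPElement.mem_of_sup_eq_top {p : ℕ} {x : G} (hx : IsPElement p x) (hp : p.Prime)
    {A B : Subgroup G} [A.Normal] (h : B ⊔ A = ⊤) (hB : ¬ p ∣ Nat.card B) : x ∈ A := by
  refine hx.mem_of_index hp A fun hd => hB ?_
  rw [← Subgroup.relIndex_top_right, ← h, Subgroup.relIndex_sup_right] at hd
  exact hd.trans (Subgroup.index_dvd_card _)

theorem card_iSup_dvd_prod [Finite G] {κ : Type*} [Fintype κ] {K : κ → Subgroup G}
    (hK : Pairwise fun i j => ∀ x y : G, x ∈ K i → y ∈ K j → Commute x y) :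
    Nat.card (⨆ k, K k : Subgroup G) ∣ ∏ k, Nat.card (K k) := by
  rw [← Subgroup.noncommPiCoprod_range (hcomm := hK), ← Nat.card_pi]
  exact Subgroup.card_range_dvd _

/-- Burnside transfer. For q outside π, a Sylow q-subgroup Q is centralised by all generators, hence
central. The transfer into Q kills the generators, whose orders are prime to q, so its kernel is the
whole group; but Q complements that kernel. -/
theorem isPiGroup_piClosure [Finite G] {π : Set ℕ}
    (h : ∀ p q : ℕ, p.Prime → q.Prime → p ∈ π → q ∉ π →
      ∀ x y : G, IsPElement p x → IsPElement q y → Commute x y) :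
    IsPiGroup π (piClosure π G) := by
  intro q hq hd
  by_contra hqπ
  have := Fact.mk hq
  obtain ⟨Q⟩ : Nonempty (Sylow q (piClosure π G)) := inferInstance
  have hcent : Subgroup.normalizer (Q : Set (piClosure π G)) ≤
      Subgroup.centralizer (Q : Set (piClosure π G)) := by
    intro g _ y hy
    have h1 : piClosure π G ≤ Subgroup.centralizer {(y : G)} := by
      refine (Subgroup.closure_le _).2 ?_
      rintro x ⟨p, hp, hpπ, hx⟩
      rw [SetLike.mem_coe, Subgroup.mem_centralizer_singleton_iff]
      exact h p q hp hq hpπ hqπ x y hx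
        ((isPElement_of_isPGroup Q.isPGroup' hy).map (Subgroup.subtype _))
    have h2 := h1 g.2
    rw [Subgroup.mem_centralizer_singleton_iff] at h2
    exact Subtype.ext h2.symm
  have hc := MonoidHom.ker_transferSylow_isComplement' Q hcent
  have htop : (MonoidHom.transferSylow Q hcent).ker = ⊤ := by
    have h1 : piClosure π G ≤
        (MonoidHom.transferSylow Q hcent).ker.map (piClosure π G).subtype := by
      refine (Subgroup.closure_le _).2 ?_
      rintro x ⟨p, hp, hpπ, hx⟩
      refine ⟨⟨x, hx.mem_piClosure hp hpπ⟩, ?_, rfl⟩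
      rw [SetLike.mem_coe, MonoidHom.mem_ker]
      have hx' : IsPElement p (⟨x, hx.mem_piClosure hp hpπ⟩ : piClosure π G) :=
        IsPElement.of_map (Subgroup.subtype _) (Subgroup.subtype_injective _) hx
      refine (hx'.map (MonoidHom.transferSylow Q hcent)).eq_one_of_ne hp hq ?_
        (Q.isPGroup' _)
      rintro rfl
      exact hqπ hpπ
    rw [eq_top_iff]
    intro y _
    obtain ⟨z, hz, hzy⟩ := h1 y.2
    rwa [← Subtype.ext (a1 := z) (a2 := y) hzy]
  rw [htop] at hc
  have hQ : (Q : Subgroup (piClosure π G)) = ⊥ := by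
    have := hc.disjoint
    rwa [top_disjoint] at this
  have := Q.not_dvd_index
  rw [hQ, Subgroup.index_bot] at this
  exact this hd

/-- In a direct product of σ-primary factors, each p-element with p in σ_i lies in the product of
the factors assigned to i, by looking at indices. Conversely the subgroups `piClosure (σ i) G`, for
the finitely many blocks meeting the order, commute and have coprime orders. -/
theorem isSigmaNilpotent_iff [Finite G] (hσ : IsPrimePartition σ) :
    IsSigmaNilpotent σ G ↔ SigmaCommuting σ G := by
  classical
  constructor
  · rintro ⟨n, K, hN, hprim, hind, hsup⟩
    choose b hb using hprim
    have hcomm : Pairwise fun i j => ∀ x y : G, x ∈ K i → y ∈ K j → Commute x y :=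
      fun i j hij => Subgroup.commute_of_normal_of_disjoint _ _ (hN i) (hN j)
        (hind.pairwiseDisjoint hij)
    have key : ∀ i, ∀ p : ℕ, p.Prime → p ∈ σ i → ∀ x : G, IsPElement p x →
        x ∈ ⨆ j : {j // b j = i}, K j := by
      intro i p hp hpi x hx
      have hAn : (⨆ j : {j // b j = i}, K j).Normal :=
        Subgroup.iSup_normal fun j : {j // b j = i} => K j
      have htop : (⨆ j : {j // b j ≠ i}, K j) ⊔ (⨆ j : {j // b j = i}, K j) = ⊤ := by
        rw [eq_top_iff, ← hsup]
        refine iSup_le fun j => ?_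
        by_cases hj : b j = i
        · exact (le_iSup (fun j : {j // b j = i} => K j) ⟨j, hj⟩).trans le_sup_right
        · exact (le_iSup (fun j : {j // b j ≠ i} => K j) ⟨j, hj⟩).trans le_sup_left
      refine hx.mem_of_sup_eq_top hp htop fun hd => ?_
      have hd2 := hd.trans (card_iSup_dvd_prod (K := fun j : {j // b j ≠ i} => K j)
          fun j k hjk => hcomm (Subtype.coe_ne_coe.2 hjk))
      obtain ⟨j, -, hj⟩ := (Nat.Prime.prime hp).exists_mem_finset_dvd hd2
      exact j.2 (block_unique hσ (hb j p hp hj) hpi)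
    intro i p q hp hq hpi hqi x y hx hy
    obtain ⟨k, hqk⟩ := exists_mem_block hσ hq
    have h1 := key i p hp hpi x hx
    have h2 := key k q hq hqk y hy
    have hle : (⨆ j : {j // b j = i}, K j) ≤
        Subgroup.centralizer ((⨆ j : {j // b j = k}, K j : Subgroup G) : Set G) := by
      refine iSup_le fun j => ?_
      rw [Subgroup.le_centralizer_iff]
      refine iSup_le fun l => ?_
      intro z hz w hw
      refine hcomm ?_ w z hw hz
      intro hjl
      apply hqi
      rwa [← j.2, hjl, l.2]
    exact (hle h1 y h2).symm
  · intro h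
    have hS : Set.Finite {i | ∃ p ∈ (Nat.card G).primeFactors, p ∈ σ i} := by
      have : {i | ∃ p ∈ (Nat.card G).primeFactors, p ∈ σ i} =
          ⋃ p ∈ (Nat.card G).primeFactors, {i | p ∈ σ i} := by ext; simp
      rw [this]
      exact Set.Finite.biUnion (Finset.finite_toSet _) fun p _ =>
        Set.Subsingleton.finite fun i hi j hj => block_unique hσ hi hj
    have := hS.fintype
    let e := Fintype.equivFin {i | ∃ p ∈ (Nat.card G).primeFactors, p ∈ σ i}
    have hpi : ∀ i, IsPiGroup (σ i) (piClosure (σ i) G) := fun i => isPiGroup_piClosure (h i)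
    have hne : ∀ {k l}, k ≠ l → ((e.symm k : _) : ι) ≠ (e.symm l : _) := fun hkl =>
      Subtype.coe_ne_coe.2 (e.symm.injective.ne hkl)
    refine ⟨_, fun k => piClosure (σ (e.symm k)) G, fun k => inferInstance,
      fun k => ⟨_, hpi _⟩, ?_, ?_⟩
    · have := fun k => Fintype.ofFinite (piClosure (σ (e.symm k)) G)
      refine Subgroup.independent_of_coprime_order ?_ ?_
      · intro k l hkl x y hx hy
        have hle : piClosure (σ (e.symm k)) G ≤
            Subgroup.centralizer (piClosure (σ (e.symm l)) G : Set G) := by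
          refine (Subgroup.closure_le _).2 ?_
          rintro x ⟨p, hp, hpπ, hx⟩ y hy
          have hle : piClosure (σ (e.symm l)) G ≤ Subgroup.centralizer {x} := by
            refine (Subgroup.closure_le _).2 ?_
            rintro y ⟨q, hq, hqπ, hy⟩
            rw [SetLike.mem_coe, Subgroup.mem_centralizer_singleton_iff]
            exact (h _ p q hp hq hpπ (fun hq' => hne hkl (block_unique hσ hq' hqπ)) x y hx hy).symm
          exact Subgroup.mem_centralizer_singleton_iff.1 (hle hy)
        exact (hle hx y hy).symm
      · intro k l hkl
        have hcard : ∀ k, Fintype.card (piClosure (σ (e.symm k)) G) =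
            Nat.card (piClosure (σ (e.symm k)) G) := fun k => Nat.card_eq_fintype_card.symm
        rw [hcard k, hcard l]
        refine Nat.Coprime.symm (Nat.coprime_of_dvd fun p hp h1 h2 => ?_)
        exact hne hkl (block_unique hσ (hpi _ p hp h2) (hpi _ p hp h1))
    · rw [eq_top_iff]
      refine le_of_forall_isPElement fun p hp x _ hx => ?_
      by_cases hx1 : x = 1
      · rw [hx1]; exact Subgroup.one_mem _
      obtain ⟨i, hi⟩ := exists_mem_block hσ hp
      have hd : p ∣ Nat.card G := by
        simpa using hx.dvd_card hp hx1 (H := ⊤) trivial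
      have hiS : i ∈ {i | ∃ p ∈ (Nat.card G).primeFactors, p ∈ σ i} :=
        ⟨p, Nat.mem_primeFactors.2 ⟨hp, hd, Nat.card_pos.ne'⟩, hi⟩
      refine (le_iSup (fun k => piClosure (σ (e.symm k)) G) (e ⟨i, hiS⟩)) ?_
      simp only [Equiv.symm_apply_apply]
      exact hx.mem_piClosure hp hi

theorem isSigmaNilpotent_quotient_iff [Finite G] (hσ : IsPrimePartition σ) (N : Subgroup G)
    [N.Normal] : IsSigmaNilpotent σ (G ⧸ N) ↔
      ∀ i, ∀ p q : ℕ, p.Prime → q.Prime → p ∈ σ i → q ∉ σ i →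
        ∀ x y : G, IsPElement p x → IsPElement q y → ⁅x, y⁆ ∈ N := by
  rw [isSigmaNilpotent_iff hσ]
  refine forall_congr' fun i => forall_congr' fun p => forall_congr' fun q =>
    forall_congr' fun hp => forall_congr' fun hq => forall_congr' fun hpi =>
    forall_congr' fun hqi => ?_
  constructor
  · intro h x y hx hy
    have := h _ _ (hx.map (QuotientGroup.mk' N)) (hy.map (QuotientGroup.mk' N))
    rw [← commutatorElement_eq_one_iff_commute, ← map_commutatorElement] at this
    exact (QuotientGroup.eq_one_iff _).1 this
  · intro h x' y' hx' hy'
    obtain ⟨x, hx, rfl⟩ := exists_isPElement_lift (QuotientGroup.mk'_surjective N) hp hx'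
    obtain ⟨y, hy, rfl⟩ := exists_isPElement_lift (QuotientGroup.mk'_surjective N) hq hy'
    rw [← commutatorElement_eq_one_iff_commute, ← map_commutatorElement]
    exact (QuotientGroup.eq_one_iff _).2 (h x y hx hy)

theorem sigmaResidual_le (N : Subgroup G) [hN : N.Normal] (h : IsSigmaNilpotent σ (G ⧸ N)) :
    sigmaResidual σ G ≤ N := sInf_le ⟨hN, h⟩

instance sigmaResidual_normal : (sigmaResidual σ G).Normal := by
  constructor
  intro n hn g
  rw [sigmaResidual, Subgroup.mem_sInf] at hn ⊢
  rintro N ⟨hN, h⟩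
  exact hN.conj_mem n (hn N ⟨hN, h⟩) g

theorem commutator_mem_sigmaResidual [Finite G] (hσ : IsPrimePartition σ) {i : ι} {p q : ℕ}
    (hp : p.Prime) (hq : q.Prime) (hpi : p ∈ σ i) (hqi : q ∉ σ i) {x y : G}
    (hx : IsPElement p x) (hy : IsPElement q y) : ⁅x, y⁆ ∈ sigmaResidual σ G := by
  rw [sigmaResidual, Subgroup.mem_sInf]
  rintro N ⟨hN, h⟩
  exact (isSigmaNilpotent_quotient_iff hσ N).1 h i p q hp hq hpi hqi x y hx hy

theorem isSigmaNilpotent_quotient_sigmaResidual [Finite G] (hσ : IsPrimePartition σ) :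
    IsSigmaNilpotent σ (G ⧸ sigmaResidual σ G) :=
  (isSigmaNilpotent_quotient_iff hσ _).2 fun _ _ _ hp hq hpi hqi _ _ hx hy =>
    commutator_mem_sigmaResidual hσ hp hq hpi hqi hx hy

theorem sigmaResidual_map [Finite G] [Finite G'] (hσ : IsPrimePartition σ) {f : G →* G'}
    (hf : Function.Surjective f) : (sigmaResidual σ G).map f = sigmaResidual σ G' := by
  apply le_antisymm
  · rw [Subgroup.map_le_iff_le_comap]
    refine sigmaResidual_le _ ((isSigmaNilpotent_quotient_iff hσ _).2 ?_)
    intro i p q hp hq hpi hqi x y hx hy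
    rw [Subgroup.mem_comap, map_commutatorElement]
    exact commutator_mem_sigmaResidual hσ hp hq hpi hqi (hx.map f) (hy.map f)
  · have := Subgroup.Normal.map (sigmaResidual_normal (σ := σ) (G := G)) f hf
    refine sigmaResidual_le _ ((isSigmaNilpotent_quotient_iff hσ _).2 ?_)
    intro i p q hp hq hpi hqi x' y' hx' hy'
    obtain ⟨x, hx, rfl⟩ := exists_isPElement_lift hf hp hx'
    obtain ⟨y, hy, rfl⟩ := exists_isPElement_lift hf hq hy'
    exact ⟨_, commutator_mem_sigmaResidual hσ hp hq hpi hqi hx hy, map_commutatorElement ..⟩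

/-- Choose a p-element outside A, p in σ_i, and let H be the σ_i-part of G. The σ_i'-elements of A
generate a subgroup N normalised by A and centralised by H, and AH/N is a σ_i-group. -/
theorem SigmaCommuting.exists_step [Finite G] (hσ : IsPrimePartition σ) (h : SigmaCommuting σ G)
    {A : Subgroup G} (hA : A ≠ ⊤) : ∃ B, A < B ∧ SigmaSubnormalStep σ A B := by
  have : ∃ p : ℕ, p.Prime ∧ ∃ x : G, IsPElement p x ∧ x ∉ A := by
    by_contra! hc
    exact hA (eq_top_iff.2 (le_of_forall_isPElement fun p hp x _ hx => hc p hp x hx))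
  obtain ⟨p, hp, x, hx, hxA⟩ := this
  obtain ⟨i, hi⟩ := exists_mem_block hσ hp
  have hxH : x ∈ piClosure (σ i) G := hx.mem_piClosure hp hi
  set N := Subgroup.closure {z | z ∈ A ∧ ∃ q : ℕ, q.Prime ∧ q ∉ σ i ∧ IsPElement q z} with hNdef
  have hNA : N ≤ A := (Subgroup.closure_le _).2 fun z hz => hz.1
  have hcomm : ∀ z ∈ N, ∀ w ∈ piClosure (σ i) G, Commute w z := by
    have hle : piClosure (σ i) G ≤ Subgroup.centralizer (N : Set G) := by
      rw [Subgroup.le_centralizer_iff]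
      refine (Subgroup.closure_le _).2 ?_
      rintro z ⟨-, q, hq, hqi, hz⟩
      rw [SetLike.mem_coe, ← Subgroup.zpowers_le, ← Subgroup.le_centralizer_iff]
      refine (Subgroup.closure_le _).2 ?_
      rintro w ⟨r, hr, hri, hw⟩
      rw [SetLike.mem_coe, Subgroup.mem_centralizer_iff]
      rintro _ ⟨n, rfl⟩
      exact ((h i r q hr hq hri hqi w z hw hz).zpow_right n).symm
    intro z hz w hw
    exact (Subgroup.mem_centralizer_iff.1 (hle hw) z hz).symm
  have hAle : A ≤ N ⊔ piClosure (σ i) G := by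
    refine le_of_forall_isPElement fun q hq y hyA hy => ?_
    by_cases hqi : q ∈ σ i
    · exact Subgroup.mem_sup_right (hy.mem_piClosure hq hqi)
    · exact Subgroup.mem_sup_left (Subgroup.subset_closure ⟨hyA, q, hq, hqi, hy⟩)
  refine ⟨A ⊔ piClosure (σ i) G, lt_of_le_not_ge le_sup_left fun hle =>
    hxA (hle (Subgroup.mem_sup_right hxH)), ?_⟩
  rw [sigmaSubnormalStep_iff]
  refine ⟨le_sup_left, Or.inr ⟨i, N, hNA, ?_, ?_⟩⟩
  · intro n hn b hb
    obtain ⟨a, ha, w, hw, rfl⟩ := Subgroup.mem_sup_of_normal_right.1 hb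
    have h1 : a * w * n * (a * w)⁻¹ = a * n * a⁻¹ := by
      rw [mul_assoc a w n, (hcomm n hn w hw).eq]; group
    rw [h1]
    have h2 : N ≤ N.comap (MulAut.conj a).toMonoidHom := by
      refine (Subgroup.closure_le _).2 ?_
      rintro z ⟨hz, q, hq, hqi, hzq⟩
      exact Subgroup.subset_closure ⟨A.mul_mem (A.mul_mem ha hz) (A.inv_mem ha), q, hq, hqi,
        hzq.conj a⟩
    exact h2 hn
  · intro q hq hqi y hy hyq
    have hy' : y ∈ N ⊔ piClosure (σ i) G := (sup_le hAle le_sup_right) hy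
    obtain ⟨n, hn, w, hw, rfl⟩ := Subgroup.mem_sup_of_normal_right.1 hy'
    obtain ⟨k, hk⟩ := hyq
    refine N.mul_mem hn ?_
    have h1 : w ^ Nat.card (piClosure (σ i) G) = 1 :=
      congrArg Subtype.val (pow_card_eq_one' (x := (⟨w, hw⟩ : piClosure (σ i) G)))
    -- Since y = nw is a q-element and n, w commute, a q-power power of w lies in N; the order of w
    -- divides a σ_i-number, prime to q, so w itself lies in N.
    refine mem_of_pow_mem h1 (m := q ^ k) (Nat.Coprime.pow_left _
      ((Nat.Prime.coprime_iff_not_dvd hq).2 fun hd =>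
        hqi (isPiGroup_piClosure (h i) q hq hd))) ?_
    rw [(hcomm n hn w hw).symm.mul_pow] at hk
    rw [eq_inv_of_mul_eq_one_right hk]
    exact N.inv_mem (N.pow_mem hn _)

theorem SigmaCommuting.isSigmaSubnormal [Finite G] (hσ : IsPrimePartition σ)
    (h : SigmaCommuting σ G) (A : Subgroup G) : IsSigmaSubnormal σ A := by
  induction A using WellFoundedGT.induction with
  | ind A ih =>
    by_cases hA : A = ⊤
    · rw [hA]; exact Relation.ReflTransGen.refl
    · obtain ⟨B, hAB, hs⟩ := h.exists_step hσ hA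
      exact Relation.ReflTransGen.head hs (ih B hAB)

end Nilpotent

/-! ### Finite groups with modular subgroup lattice are soluble -/

section ModularLattice

variable {G : Type*} [Group G]

theorem eq_bot_or_eq_of_card_prime [Finite G] {X A : Subgroup G} (hA : (Nat.card A).Prime)
    (hX : X ≤ A) : X = ⊥ ∨ X = A := by
  rcases (Nat.dvd_prime hA).1 (Subgroup.card_dvd_of_le hX) with h | h
  · exact Or.inl (Subgroup.card_eq_one.1 h)
  · exact Or.inr (Subgroup.eq_of_le_of_card_ge hX h.ge)

theorem bot_covBy_of_card_prime [Finite G] {A : Subgroup G} (hA : (Nat.card A).Prime) : ⊥ ⋖ A := by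
  refine ⟨bot_lt_iff_ne_bot.2 ?_, fun X hX hXA => ?_⟩
  · rintro rfl
    rw [Subgroup.card_bot] at hA
    exact hA.ne_one rfl
  · rcases eq_bot_or_eq_of_card_prime hA hXA.le with h | h
    · exact hX.ne' h
    · exact hXA.ne h

theorem card_zpowers_of_prime {p : ℕ} (hp : p.Prime) {x : G} (hx : x ^ p = 1) (h1 : x ≠ 1) :
    Nat.card (Subgroup.zpowers x) = p := by
  have := Fact.mk hp
  rw [Nat.card_zpowers, orderOf_eq_prime hx h1]

/-- By modularity A is maximal. If it were not normal it would be self-normalising, hence a Sylow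
subgroup with a normal p-complement N by Burnside. Any subgroup of prime order in N generates G with
A, so modularity makes |N| a prime q, and Sylow counting gives q ≡ 1 mod p, against q ≤ p. -/
theorem normal_of_card_eq_max_prime [Finite G] (hG : IsModularLattice (Subgroup G)) {p : ℕ}
    (hp : p.Prime) (hmax : ∀ q : ℕ, q.Prime → q ∣ Nat.card G → q ≤ p) {A B : Subgroup G}
    (hA : Nat.card A = p) (hB : Nat.card B = p) (hAB : A ≠ B) (hsup : A ⊔ B = ⊤) :
    A.Normal := by
  have := Fact.mk hp
  have hinf : A ⊓ B = ⊥ := by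
    rcases eq_bot_or_eq_of_card_prime (hA ▸ hp) (inf_le_left : A ⊓ B ≤ A) with h | h
    · exact h
    · exact absurd (Subgroup.eq_of_le_of_card_ge (inf_eq_left.1 h) (by rw [hA, hB])) hAB
  have hcov : A ⋖ ⊤ := by
    have h1 : B ⊓ A ⋖ B := by
      rw [inf_comm, hinf]; exact bot_covBy_of_card_prime (hB ▸ hp)
    have h2 := covBy_sup_of_inf_covBy_left h1
    rwa [sup_comm, hsup] at h2
  rcases hcov.eq_or_eq (c := Subgroup.normalizer (A : Set G)) Subgroup.le_normalizer le_top
    with hN | hN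
  swap
  · exact Subgroup.normalizer_eq_top_iff.1 hN
  exfalso
  have hidx : ¬ p ∣ A.index := by
    intro hd
    have h1 : p ^ (1 + 1) ∣ Nat.card G := by
      rw [← A.card_mul_index, hA, pow_succ, pow_one]; exact mul_dvd_mul_left p hd
    have h2 := Sylow.prime_pow_dvd_card_normalizer h1 (H := A) (by rw [hA, pow_one])
    rw [hN, hA] at h2
    have h3 := Nat.le_of_dvd hp.pos h2
    exact absurd h3 (not_le.2 (lt_self_pow₀ hp.one_lt (by norm_num)))
  have hcyc : IsCyclic A := isCyclic_of_prime_card hA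
  have hpA : IsPGroup p A := IsPGroup.of_card (n := 1) (by rw [hA, pow_one])
  have hcomm : Subgroup.normalizer (hpA.toSylow hidx : Set G) ≤
      Subgroup.centralizer (hpA.toSylow hidx : Set G) := by
    intro g hg y hy
    have hg' : g ∈ A := by rw [← hN]; exact hg
    have hc := (IsCyclic.commGroup (α := A)).mul_comm ⟨y, hy⟩ ⟨g, hg'⟩
    exact congrArg Subtype.val hc
  have hc := MonoidHom.ker_transferSylow_isComplement' (hpA.toSylow hidx) hcomm
  set N := (MonoidHom.transferSylow (hpA.toSylow hidx) hcomm).ker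
  have hsup' : N ⊔ A = ⊤ := hc.sup_eq_top
  have hinf' : N ⊓ A = ⊥ := disjoint_iff.1 hc.disjoint
  have hcard : Nat.card N * p = Nat.card G := by rw [← hA]; exact hc.card_mul_card
  have hN1 : Nat.card N ≠ 1 := by
    intro h
    rw [Subgroup.card_eq_one] at h
    rw [h, bot_sup_eq] at hsup'
    exact hcov.lt.ne hsup'
  obtain ⟨q, hq, hqd⟩ := Nat.exists_prime_and_dvd hN1
  have := Fact.mk hq
  obtain ⟨z, hz⟩ := exists_prime_orderOf_dvd_card' q hqd
  have hzN : Subgroup.zpowers (z : G) ≤ N := by rw [Subgroup.zpowers_le]; exact z.2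
  have hz1 : (z : G) ≠ 1 := by
    intro h
    rw [← orderOf_eq_one_iff, Subgroup.orderOf_coe, hz] at h
    exact hq.ne_one h
  have hzA : Subgroup.zpowers (z : G) ⊔ A = ⊤ := by
    rcases hcov.eq_or_eq (c := Subgroup.zpowers (z : G) ⊔ A) le_sup_right le_top with h | h
    · exfalso
      have : (z : G) ∈ N ⊓ A := ⟨z.2, by
        rw [← h]; exact Subgroup.mem_sup_left (Subgroup.mem_zpowers _)⟩
      rw [hinf', Subgroup.mem_bot] at this
      exact hz1 this
    · exact h
  have hzeq : Subgroup.zpowers (z : G) = N := by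
    have h1 := sup_inf_assoc_of_le A hzN
    rw [hzA, top_inf_eq, inf_comm, hinf', sup_bot_eq] at h1
    exact h1.symm
  have hNq : Nat.card N = q := by
    rw [← hzeq, Nat.card_zpowers, Subgroup.orderOf_coe, hz]
  -- As A is its own normaliser, the number of Sylow p-subgroups is the index of A, which is |N| =
  -- q.
  have hq1 : q ≡ 1 [MOD p] := by
    have h1 := card_sylow_modEq_one p G
    rw [(hpA.toSylow hidx).card_eq_index_normalizer] at h1
    have h2 : Subgroup.normalizer (hpA.toSylow hidx : Set G) = A := hN
    have h3 : A.index = Nat.card N := hc.index_eq_card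
    rwa [h2, h3, hNq] at h1
  have hqp : q ≤ p := hmax q hq (by rw [← hcard, hNq]; exact dvd_mul_right _ _)
  rcases hqp.eq_or_lt with h | h
  · rw [h] at hq1
    have := (Nat.modEq_iff_dvd' hp.one_lt.le).1 hq1.symm
    have := Nat.le_of_dvd (by have := hp.two_le; omega) this
    have := hp.two_le
    omega
  · have := Nat.ModEq.eq_of_lt_of_lt hq1 h hp.one_lt
    exact hq.ne_one this

theorem commute_of_max_prime [Finite G] (hG : IsModularLattice (Subgroup G)) {p : ℕ}
    (hp : p.Prime) (hmax : ∀ q : ℕ, q.Prime → q ∣ Nat.card G → q ≤ p) {x y : G}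
    (hx : x ^ p = 1) (hy : y ^ p = 1) : Commute x y := by
  by_cases hx1 : x = 1
  · rw [hx1]; exact Commute.one_left y
  by_cases hy1 : y = 1
  · rw [hy1]; exact Commute.one_right x
  by_cases hxy : Subgroup.zpowers x = Subgroup.zpowers y
  · have : x ∈ Subgroup.zpowers y := by rw [← hxy]; exact Subgroup.mem_zpowers x
    obtain ⟨n, rfl⟩ := this
    exact (Commute.refl y).zpow_left n
  set L := Subgroup.zpowers x ⊔ Subgroup.zpowers y
  have hxL : Subgroup.zpowers x ≤ L := le_sup_left
  have hyL : Subgroup.zpowers y ≤ L := le_sup_right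
  have hL : IsModularLattice (Subgroup L) := isModularLattice_of_injective hG L.subtype_injective
  have hmaxL : ∀ q : ℕ, q.Prime → q ∣ Nat.card L → q ≤ p := fun q hq hd =>
    hmax q hq (hd.trans L.card_subgroup_dvd_card)
  have hcx : Nat.card ((Subgroup.zpowers x).subgroupOf L) = p := by
    rw [Nat.card_congr (Subgroup.subgroupOfEquivOfLe hxL).toEquiv, card_zpowers_of_prime hp hx hx1]
  have hcy : Nat.card ((Subgroup.zpowers y).subgroupOf L) = p := by
    rw [Nat.card_congr (Subgroup.subgroupOfEquivOfLe hyL).toEquiv, card_zpowers_of_prime hp hy hy1]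
  have hne : (Subgroup.zpowers x).subgroupOf L ≠ (Subgroup.zpowers y).subgroupOf L := fun h => hxy <| by
    rw [← Subgroup.map_subgroupOf_eq_of_le hxL, h, Subgroup.map_subgroupOf_eq_of_le hyL]
  have hsup : (Subgroup.zpowers x).subgroupOf L ⊔ (Subgroup.zpowers y).subgroupOf L = ⊤ := by
    rw [← Subgroup.subgroupOf_sup hxL hyL, Subgroup.subgroupOf_self]
  have h1 := normal_of_card_eq_max_prime hL hp hmaxL hcx hcy hne hsup
  have h2 := normal_of_card_eq_max_prime hL hp hmaxL hcy hcx hne.symm (by rw [sup_comm, hsup])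
  have hdisj : Disjoint ((Subgroup.zpowers x).subgroupOf L) ((Subgroup.zpowers y).subgroupOf L) := by
    rw [disjoint_iff]
    rcases eq_bot_or_eq_of_card_prime (hcx ▸ hp) (inf_le_left :
      (Subgroup.zpowers x).subgroupOf L ⊓ (Subgroup.zpowers y).subgroupOf L ≤ _) with h | h
    · exact h
    · exact absurd (Subgroup.eq_of_le_of_card_ge (inf_eq_left.1 h) (by rw [hcx, hcy])) hne
  have h3 := Subgroup.commute_of_normal_of_disjoint _ _ h1 h2 hdisj
    ⟨x, hxL (Subgroup.mem_zpowers x)⟩ ⟨y, hyL (Subgroup.mem_zpowers y)⟩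
    (Subgroup.mem_subgroupOf.2 (Subgroup.mem_zpowers x))
    (Subgroup.mem_subgroupOf.2 (Subgroup.mem_zpowers y))
  exact congrArg Subtype.val h3

theorem exists_max_prime_dvd_card (G : Type*) [Group G] [Finite G] [Nontrivial G] :
    ∃ p : ℕ, p.Prime ∧ p ∣ Nat.card G ∧ ∀ q : ℕ, q.Prime → q ∣ Nat.card G → q ≤ p := by
  have hne : (Nat.card G).primeFactors.Nonempty :=
    Nat.nonempty_primeFactors.2 Finite.one_lt_card
  refine ⟨(Nat.card G).primeFactors.max' hne, ?_, ?_, ?_⟩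
  · exact Nat.prime_of_mem_primeFactors (Finset.max'_mem _ hne)
  · exact Nat.dvd_of_mem_primeFactors (Finset.max'_mem _ hne)
  · intro q hq hd
    exact Finset.le_max' _ _ (Nat.mem_primeFactors.2 ⟨hq, hd, Nat.card_pos.ne'⟩)

theorem card_quotient_lt [Finite G] {N : Subgroup G} (hN : N ≠ ⊥) :
    Nat.card (G ⧸ N) < Nat.card G := by
  rw [N.card_eq_card_quotient_mul_card_subgroup]
  have : 1 < Nat.card N := (Subgroup.one_lt_card_iff_ne_bot N).2 hN
  exact lt_mul_of_one_lt_right Nat.card_pos this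

/-- For the largest prime divisor p, any two distinct subgroups of order p are normal in their join
and so commute. Hence the elements of order p generate a nontrivial abelian normal subgroup; induct
on the quotient. -/
theorem isSolvable_of_isModularLattice {G : Type*} [Group G] [Finite G]
    (hG : IsModularLattice (Subgroup G)) : Group.IsSolvable G := by
  induction hn : Nat.card G using Nat.strong_induction_on generalizing G with
  | _ n ih =>
  subst hn
  cases subsingleton_or_nontrivial G
  · infer_instance
  obtain ⟨p, hp, hpd, hmax⟩ := exists_max_prime_dvd_card G
  have := Fact.mk hp
  set Ω := Subgroup.closure {x : G | x ^ p = 1} with hΩ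
  have hΩn : Ω.Normal := by
    constructor
    intro n hn g
    have h : Ω ≤ Ω.comap (MulAut.conj g).toMonoidHom := by
      refine (Subgroup.closure_le _).2 fun x hx => Subgroup.subset_closure ?_
      have : (MulAut.conj g x) ^ p = 1 := by rw [← map_pow, hx, map_one]
      exact this
    exact h hn
  have hle : Ω ≤ Subgroup.centralizer (Ω : Set G) := by
    rw [Subgroup.le_centralizer_iff]
    refine (Subgroup.closure_le _).2 fun x hx => ?_
    rw [SetLike.mem_coe, ← Subgroup.zpowers_le, ← Subgroup.le_centralizer_iff]
    refine (Subgroup.closure_le _).2 fun y hy => ?_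
    rintro _ ⟨n, rfl⟩
    exact (commute_of_max_prime hG hp hmax hx hy).zpow_left n
  have hsΩ : Group.IsSolvable Ω := Group.isSolvable_of_comm fun a b =>
    Subtype.ext (Subgroup.mem_centralizer_iff.1 (hle b.2) a a.2)
  have hΩb : Ω ≠ ⊥ := by
    obtain ⟨x, hx⟩ := exists_prime_orderOf_dvd_card' p hpd
    intro h
    have hxΩ : x ∈ Ω := Subgroup.subset_closure
      (show x ^ p = 1 by rw [← hx, pow_orderOf_eq_one])
    rw [h, Subgroup.mem_bot] at hxΩ
    rw [hxΩ, orderOf_one] at hx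
    exact hp.ne_one hx.symm
  have hq : Group.IsSolvable (G ⧸ Ω) := ih _ (card_quotient_lt hΩb)
    (isModularLattice_of_surjective hG (QuotientGroup.mk'_surjective Ω)) rfl
  exact (Group.isSolvable_iff_subgroup_quotient Ω).2 ⟨hsΩ, hq⟩

/-! ### Soluble groups in which modularity is transitive -/

theorem exists_minimal_normal (G : Type*) [Group G] [Finite G] [Nontrivial G]
    [Group.IsSolvable G] :
    ∃ P : Subgroup G, P.Normal ∧ P ≠ ⊥ ∧ (∀ x ∈ P, ∀ y ∈ P, x * y = y * x) ∧
      ∀ N : Subgroup G, N.Normal → N ≤ P → N = ⊥ ∨ N = P := by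
  have hwf : WellFounded ((· < ·) : Subgroup G → Subgroup G → Prop) := wellFounded_lt
  obtain ⟨P, ⟨hPn, hPb⟩, hmin⟩ := hwf.has_min {N : Subgroup G | N.Normal ∧ N ≠ ⊥}
    ⟨⊤, inferInstance, top_ne_bot⟩
  have hmin' : ∀ N : Subgroup G, N.Normal → N ≤ P → N = ⊥ ∨ N = P := by
    intro N hN hNP
    by_contra! hc
    exact hmin N ⟨hN, hc.1⟩ (lt_of_le_of_ne hNP hc.2)
  refine ⟨P, hPn, hPb, ?_, hmin'⟩
  have hlt := Group.IsSolvable.commutator_lt_of_ne_bot hPb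
  rcases hmin' ⁅P, P⁆ inferInstance hlt.le with h | h
  · rw [Subgroup.commutator_eq_bot_iff_le_centralizer] at h
    exact fun x hx y hy => Subgroup.mem_centralizer_iff.1 (h hy) x hx
  · exact absurd h hlt.ne

/-- Modularity of subgroups is a transitive relation. -/
def ModularTransitive (G : Type*) [Group G] : Prop :=
  ∀ (K : Subgroup G) (H : Subgroup K), IsModularSubgroup H → IsModularSubgroup K →
    IsModularSubgroup (H.map K.subtype)

/-- With a single block every subgroup is σ-subnormal, so quotient closure follows from the
σ-version. -/
theorem modularTransitive_iff [Finite G] :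
    ModularTransitive G ↔ IsMSigmaTGroup (fun _ : Unit => {p : ℕ | p.Prime}) G := by
  have h : ∀ {G : Type _} [Group G] (A : Subgroup G),
      IsSigmaSubnormal (fun _ : Unit => {p : ℕ | p.Prime}) A := fun A =>
    Relation.ReflTransGen.single ⟨le_top, Or.inr ⟨(), fun p hp _ => hp⟩⟩
  exact ⟨fun hG K H hH hK => ⟨h _, hG K H hH.2 hK.2⟩,
    fun hG K H hH hK => (hG K H ⟨h _, hH⟩ ⟨h _, hK⟩).2⟩

theorem ModularTransitive.of_surjective {G' : Type*} [Group G'] [Finite G] [Finite G']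
    (h : ModularTransitive G) {f : G →* G'} (hf : Function.Surjective f) :
    ModularTransitive G' :=
  modularTransitive_iff.2 ((modularTransitive_iff.1 h).of_surjective hf)

theorem ModularTransitive.subgroup (h : ModularTransitive G) {K : Subgroup G}
    (hK : IsModularSubgroup K) : ModularTransitive K := by
  intro L H hH hL
  let e := L.equivMapOfInjective K.subtype K.subtype_injective
  have h1 := h _ (H.comap e.symm.toMonoidHom)
    ((isModularSubgroup_comap_iff e.symm.surjective).2 hH) (h K L hL hK)
  have h2 : (H.comap e.symm.toMonoidHom).map (L.map K.subtype).subtype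
      = (H.map L.subtype).map K.subtype := by
    have h3 : H.comap e.symm.toMonoidHom = H.map e.toMonoidHom :=
      (Subgroup.map_equiv_eq_comap_symm e H).symm
    rw [h3, Subgroup.map_map, Subgroup.map_map]
    rfl
  rw [h2] at h1
  exact .of_map K.subtype_injective h1

theorem normal_inf_of_sup_eq_top {P Z : Subgroup G} [hP : P.Normal]
    (hab : ∀ x ∈ P, ∀ y ∈ P, x * y = y * x) (h : Z ⊔ P = ⊤) : (Z ⊓ P).Normal := by
  constructor
  rintro n ⟨hnZ, hnP⟩ g
  refine ⟨?_, hP.conj_mem n hnP g⟩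
  have hg : g ∈ Z ⊔ P := by rw [h]; trivial
  obtain ⟨z, hz, u, hu, rfl⟩ := Subgroup.mem_sup_of_normal_right.1 hg
  have h1 : z * u * n * (z * u)⁻¹ = z * n * z⁻¹ := by
    rw [mul_assoc z u n, hab u hu n hnP]; group
  rw [h1]
  exact Z.mul_mem (Z.mul_mem hz hnZ) (Z.inv_mem hz)

/-- Let P be minimal normal. If TP ≠ G, then TP is modular in G because G/P has a modular lattice,
and T is modular in TP by induction, so T is modular in G. This settles the law for X ≤ Z unless XP
= G. In that case Z ∩ P is normal in G, hence trivial or P, and either X = Z or Z = G. -/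
theorem ModularTransitive.isModularLattice {G : Type*} [Group G] [Finite G]
    (hG : ModularTransitive G) [hs : Group.IsSolvable G] : IsModularLattice (Subgroup G) := by
  induction hn : Nat.card G using Nat.strong_induction_on generalizing G with
  | _ n ih =>
  subst hn
  cases subsingleton_or_nontrivial G
  · exact ⟨fun {X} Y Z _ => by rw [Subsingleton.elim X ⊤]; simp⟩
  obtain ⟨P, hPn, hPb, hab, hmin⟩ := exists_minimal_normal G
  have hquot : IsModularLattice (Subgroup (G ⧸ P)) :=
    ih _ (card_quotient_lt hPb) (hG.of_surjective (QuotientGroup.mk'_surjective P)) rfl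
  have hmod : ∀ T : Subgroup G, T ⊔ P ≠ ⊤ → IsModularSubgroup T := by
    intro T hT
    have hL : IsModularSubgroup (T ⊔ P) := by
      have h1 := (isModularSubgroup_comap_iff (QuotientGroup.mk'_surjective P)).2
        (isModularLattice_iff.1 hquot (T.map (QuotientGroup.mk' P)))
      rwa [Subgroup.comap_map_eq, QuotientGroup.ker_mk'] at h1
    have hcard : Nat.card (T ⊔ P : Subgroup G) < Nat.card G :=
      lt_of_le_of_ne (Nat.le_of_dvd Nat.card_pos (Subgroup.card_subgroup_dvd_card _)) fun h =>
        hT (Subgroup.eq_top_of_card_eq _ h)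
    have hlat := ih _ hcard (hG.subgroup hL) rfl
    have h2 := hG (T ⊔ P) (T.subgroupOf (T ⊔ P)) (isModularLattice_iff.1 hlat _) hL
    rwa [Subgroup.map_subgroupOf_eq_of_le le_sup_left] at h2
  refine ⟨fun {X} Y Z hXZ => ?_⟩
  by_cases hX : X ⊔ P = ⊤
  · have hZ : Z ⊔ P = ⊤ := top_le_iff.1 (hX ▸ sup_le_sup_right hXZ P)
    rcases hmin (Z ⊓ P) (normal_inf_of_sup_eq_top hab hZ) inf_le_right with h | h
    · have : X = Z := by
        have h1 := sup_inf_of_normal (N := P) hXZ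
        rw [hX, top_inf_eq, inf_comm, h, sup_bot_eq] at h1
        exact h1.symm
      rw [this]
      exact inf_le_right.trans le_sup_left
    · have : Z = ⊤ := by
        rw [← hZ, eq_comm, sup_eq_left]; exact inf_eq_right.1 h
      rw [this]; simp
  · exact ((hmod X hX).2 Y Z hXZ).ge

end ModularLattice

/-! ### The structure conditions imply that `σ`-quasinormality is transitive -/

section Sufficiency

variable {ι : Type*} {σ : ι → Set ℕ} {G : Type*} [Group G]

theorem pow_card_eq_one_of_mem {H : Subgroup G} {x : G} (hx : x ∈ H) : x ^ Nat.card H = 1 :=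
  congrArg Subtype.val (pow_card_eq_one' (x := (⟨x, hx⟩ : H)))

/-- With M a complement of D, the subgroup C = C_M(D) is normal in G = DM and contains A. If g = xc
lies in D with x in X and c in C, then g commutes with c, so g and x have the same |M|-th power; |M|
is prime to |D|, so g is a power of an element of X. -/
theorem sup_inf_le_of_centralizing [Finite G] {D A : Subgroup G} [hDn : D.Normal]
    (hD : IsHallSubgroup D) (hAD : (Nat.card A).Coprime (Nat.card D))
    (hcomm : ∀ a ∈ A, ∀ d ∈ D, Commute a d) (X : Subgroup G) : (X ⊔ A) ⊓ D ≤ X := by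
  obtain ⟨M, hM⟩ := Subgroup.exists_right_complement'_of_coprime (N := D) hD
  have hMcard : (Nat.card M).Coprime (Nat.card D) := by
    have : D.index = Nat.card M := hM.symm.index_eq_card
    rw [← this]; exact Nat.Coprime.symm hD
  have hdec : ∀ g : G, ∃ d ∈ D, ∃ m ∈ M, d * m = g := by
    intro g
    have hg : g ∈ D ⊔ M := by rw [hM.sup_eq_top]; trivial
    exact Subgroup.mem_sup_of_normal_left.1 hg
  set C := M ⊓ Subgroup.centralizer (D : Set G) with hC
  have hCcomm : ∀ c ∈ C, ∀ d ∈ D, Commute c d := fun c hc d hd =>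
    (Subgroup.mem_centralizer_iff.1 hc.2 d hd).symm
  have hCn : C.Normal := by
    constructor
    intro c hc g
    obtain ⟨d, hd, m, hm, rfl⟩ := hdec g
    have h1 : m * c * m⁻¹ ∈ C :=
      ⟨M.mul_mem (M.mul_mem hm hc.1) (M.inv_mem hm),
        (Subgroup.normal_centralizer (H := D)).conj_mem c hc.2 m⟩
    have h2 : d * m * c * (d * m)⁻¹ = m * c * m⁻¹ := by
      have := (hCcomm _ h1 d hd).eq
      calc d * m * c * (d * m)⁻¹ = d * (m * c * m⁻¹) * d⁻¹ := by group
        _ = m * c * m⁻¹ := by rw [← this]; group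
    rwa [h2]
  have hAC : A ≤ C := by
    intro a ha
    refine ⟨?_, fun d hd => (hcomm a ha d hd).symm⟩
    obtain ⟨d, hd, m, hm, hdm⟩ := hdec a
    have hm' : m = d⁻¹ * a := by rw [← hdm]; group
    have h1 : m ^ Nat.card D = a ^ Nat.card D := by
      rw [hm', ((hcomm a ha d hd).symm.inv_left).mul_pow, inv_pow, pow_card_eq_one_of_mem hd]
      simp
    exact mem_of_pow_mem (pow_card_eq_one_of_mem ha) hAD.symm (h1 ▸ M.pow_mem hm _)
  rintro g ⟨hg, hgD⟩
  have hg' : g ∈ X ⊔ C := sup_le_sup_left hAC X hg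
  obtain ⟨x, hx, c, hc, rfl⟩ := Subgroup.mem_sup_of_normal_right.1 hg'
  have hx' : x = (x * c) * c⁻¹ := by group
  have h1 : x ^ Nat.card M = (x * c) ^ Nat.card M := by
    conv_lhs => rw [hx']
    rw [((hCcomm c hc _ hgD).symm.inv_right).mul_pow, inv_pow, pow_card_eq_one_of_mem hc.1]
    simp
  exact mem_of_pow_mem (pow_card_eq_one_of_mem hgD) hMcard (h1 ▸ X.pow_mem hx _)

/-- Reduces an equality of subgroups to its image modulo D once their parts inside D are controlled.
-/
theorem eq_of_map_le_of_inf_le {D U V : Subgroup G} [D.Normal] (hVU : V ≤ U)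
    (hUD : U ⊓ D ≤ V) (h : U.map (QuotientGroup.mk' D) ≤ V.map (QuotientGroup.mk' D)) :
    V = U := by
  refine le_antisymm hVU fun u hu => ?_
  obtain ⟨v, hv, hvu⟩ := h (Subgroup.mem_map_of_mem _ hu)
  have h1 : v⁻¹ * u ∈ D := QuotientGroup.eq.1 hvu
  have h2 : v⁻¹ * u ∈ V := hUD ⟨U.mul_mem (U.inv_mem (hVU hv)) hu, h1⟩
  simpa using V.mul_mem hv h2

/-- Both laws hold modulo D. Joining A to a subgroup adds nothing inside D, so they lift, provided
the relevant intersections commute with reduction modulo D. -/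
theorem isModularSubgroup_of_centralizing [Finite G] {D A : Subgroup G} [hDn : D.Normal]
    (hD : IsHallSubgroup D) (hAD : (Nat.card A).Coprime (Nat.card D))
    (hcomm : ∀ a ∈ A, ∀ d ∈ D, Commute a d) (hmod : IsModularLattice (Subgroup (G ⧸ D))) :
    IsModularSubgroup A := by
  have key := sup_inf_le_of_centralizing hD hAD hcomm
  have hmod' := isModularLattice_iff.1 hmod
  set π := QuotientGroup.mk' D
  constructor
  · intro X Z hXZ
    refine eq_of_map_le_of_inf_le (D := D)
      (le_inf (sup_le_sup_left inf_le_left X) (sup_le hXZ inf_le_right)) ?_ ?_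
    · exact le_trans (inf_le_inf_right D inf_le_left) ((key X).trans le_sup_left)
    -- If z and a agree modulo D they have equal |D|-th powers, because a centralises D; the order
    -- of a is prime to |D|, so a is a power of that common power and lies in Z.
    · have h1 : A.map π ⊓ Z.map π ≤ (A ⊓ Z).map π := by
        rintro _ ⟨⟨a, ha, rfl⟩, z, hz, hza⟩
        refine ⟨a, ⟨ha, ?_⟩, rfl⟩
        have hd : z⁻¹ * a ∈ D := QuotientGroup.eq.1 hza
        have hz' : z = a * (z⁻¹ * a)⁻¹ := by group
        have h2 : z ^ Nat.card D = a ^ Nat.card D := by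
          conv_lhs => rw [hz']
          rw [((hcomm a ha _ hd).inv_right).mul_pow, inv_pow, pow_card_eq_one_of_mem hd]
          simp
        exact mem_of_pow_mem (pow_card_eq_one_of_mem ha) hAD.symm (h2 ▸ Z.pow_mem hz _)
      rw [Subgroup.map_sup]
      refine le_trans ?_ (sup_le_sup_left h1 _)
      rw [(hmod' (A.map π)).1 _ _ (Subgroup.map_mono hXZ), ← Subgroup.map_sup]
      exact Subgroup.map_inf_le _ _ _
  · intro Y Z hAZ
    -- Z and U meet Y in the same subgroup. Working inside A ⊔ Y, whose intersection with D lies in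
    -- Y, makes Y ⊓ U compatible with reduction modulo D.
    set U := (A ⊔ Y) ⊓ Z
    have hUD : (A ⊔ Y) ⊓ D ≤ Y := by rw [sup_comm]; exact key Y
    have hV : A ⊔ (Y ⊓ U) = U := by
      refine eq_of_map_le_of_inf_le (D := D)
        (sup_le (le_inf le_sup_left hAZ) inf_le_right) ?_ ?_
      · exact le_sup_of_le_right (le_inf ((inf_le_inf_right D inf_le_left).trans hUD) inf_le_left)
      · have h1 : Y.map π ⊓ U.map π ≤ (Y ⊓ U).map π := by
          rintro _ ⟨⟨y, hy, rfl⟩, u, hu, huy⟩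
          refine ⟨u, ⟨?_, hu⟩, huy⟩
          have hd : u⁻¹ * y ∈ D := QuotientGroup.eq.1 huy
          have h2 : u⁻¹ * y ∈ Y := hUD ⟨(A ⊔ Y).mul_mem ((A ⊔ Y).inv_mem hu.1)
            (Subgroup.mem_sup_right hy), hd⟩
          have h3 : u = y * (u⁻¹ * y)⁻¹ := by group
          rw [h3]
          exact Y.mul_mem hy (Y.inv_mem h2)
        rw [Subgroup.map_sup]
        refine le_trans ?_ (sup_le_sup_left h1 _)
        rw [(hmod' (A.map π)).2 _ _ (Subgroup.map_mono (le_inf le_sup_left hAZ)),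
          ← Subgroup.map_sup]
        exact le_inf (Subgroup.map_mono inf_le_left) le_rfl
    refine le_antisymm (le_inf (sup_le_sup_left inf_le_left _) (sup_le hAZ inf_le_right)) ?_
    rw [← hV]
    exact sup_le_sup_left (inf_le_inf_left Y inf_le_right) A

theorem IsPElement.mem_map_piCore [Finite G] {π : Set ℕ} {p : ℕ} {D : Subgroup G} {d : G}
    (hdp : IsPElement p d) (hp : p.Prime) (hpπ : p ∈ π)
    (hab : ∀ a ∈ D, ∀ b ∈ D, Commute a b) (hd : d ∈ D) : d ∈ (piCore π D).map D.subtype := by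
  have hdp' : IsPElement p (⟨d, hd⟩ : D) := .of_map D.subtype D.subtype_injective hdp
  refine ⟨⟨d, hd⟩, ?_, rfl⟩
  have hle : Subgroup.zpowers (⟨d, hd⟩ : D) ≤ piCore π D := by
    refine le_sSup ⟨⟨fun n hn g => ?_⟩, isPiGroup_subgroup_iff.2 fun q hq hqπ x hx hxq => ?_⟩
    · have hgn : g * n = n * g := Subtype.ext (hab g g.2 n n.2).eq
      rw [hgn, mul_inv_cancel_right]; exact hn
    · exact (hdp'.mem_zpowers hx).eq_one_of_ne hp hq (by rintro rfl; exact hqπ hpπ) hxq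
  exact hle (Subgroup.mem_zpowers _)

namespace StructureConditions

variable {D M : Subgroup G}

theorem normal_of_le (S : StructureConditions σ D M) {E : Subgroup G} (hE : E ≤ D) :
    E.Normal := by
  constructor
  intro e he g
  have := S.normal
  have h1 := S.power g (E.subgroupOf D)
  have h2 : (MulAut.conjNormal g : MulAut D) ⟨e, hE he⟩ ∈ E.subgroupOf D := by
    rw [← h1]
    exact Subgroup.mem_map_of_mem _ (show (⟨e, hE he⟩ : D) ∈ E.subgroupOf D from he)
  simpa [Subgroup.mem_subgroupOf] using h2

theorem commute_of_mem (S : StructureConditions σ D M) {a b : G} (ha : a ∈ D) (hb : b ∈ D) :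
    Commute a b := by
  have := S.abelian
  exact congrArg Subtype.val (mul_comm' (⟨a, ha⟩ : D) ⟨b, hb⟩)

/-- The Hall σ_i-subgroup is the direct product of the abelian group E = O_{σ_i}(D) and the
complement, so it centralises E. The centraliser of E is normal of index prime to σ_i, hence
contains every σ_i-element x of prime power order. -/
theorem commute_of_block [Finite G] (S : StructureConditions σ D M) {i : ι} {p q : ℕ}
    (hp : p.Prime) (hq : q.Prime) (hpi : p ∈ σ i) (hqi : q ∈ σ i) {x d : G}
    (hx : IsPElement p x) (hd : d ∈ D) (hdq : IsPElement q d) : Commute x d := by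
  obtain ⟨H, hH, hle, T, hT, hc⟩ := S.complement i
  set E := (piCore (σ i) D).map D.subtype
  have hED : E ≤ D := Subgroup.map_subtype_le _
  have hEn : E.Normal := S.normal_of_le hED
  have hHC : H ≤ Subgroup.centralizer (E : Set G) := by
    intro h hh e he
    have hmem : (⟨h, hh⟩ : H) ∈ E.subgroupOf H ⊔ T := by rw [hc.sup_eq_top]; trivial
    obtain ⟨a, ha, t, ht, hat⟩ := Subgroup.mem_sup_of_normal_right.1 hmem
    have h1 : Commute (⟨e, hle he⟩ : H) t :=
      Subgroup.commute_of_normal_of_disjoint _ _ (hEn.subgroupOf H) hT hc.disjoint _ _ he ht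
    have h2 : Commute (⟨e, hle he⟩ : H) a :=
      Subtype.ext (S.commute_of_mem (hED he) (hED ha)).eq
    have h3 := h2.mul_right h1
    rw [hat] at h3
    exact congrArg Subtype.val h3.eq
  have hxC : x ∈ Subgroup.centralizer (E : Set G) :=
    hx.mem_of_index hp _ fun hdvd =>
      hH.2 p hp (hdvd.trans (Subgroup.index_dvd_of_le hHC)) hpi
  exact (Subgroup.mem_centralizer_iff.1 hxC d 
    (hdq.mem_map_piCore hq hqi (fun _ ha _ hb => S.commute_of_mem ha hb) hd)).symm

theorem exists_mul (S : StructureConditions σ D M) (g : G) : ∃ d ∈ D, ∃ m ∈ M, d * m = g := by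
  have := S.normal
  have hg : g ∈ D ⊔ M := by rw [S.compl.sup_eq_top]; trivial
  exact Subgroup.mem_sup_of_normal_left.1 hg

theorem surjective_comp_subtype (S : StructureConditions σ D M) {G' : Type*} [Group G']
    {f : G →* G'} (hf : Function.Surjective f) (hD : D ≤ f.ker) :
    Function.Surjective (f.comp M.subtype) := by
  intro y
  obtain ⟨g, rfl⟩ := hf y
  obtain ⟨d, hd, m, hm, rfl⟩ := S.exists_mul g
  refine ⟨⟨m, hm⟩, ?_⟩
  rw [map_mul, hD hd, one_mul]; rfl

theorem isSolvable [Finite G] (S : StructureConditions σ D M) : Group.IsSolvable G := by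
  have := S.normal
  have hM := isSolvable_of_isModularLattice S.modular
  have h1 : Group.IsSolvable (G ⧸ D) :=
    Group.isSolvable_of_surjective (S.surjective_comp_subtype (QuotientGroup.mk'_surjective D)
      (by rw [QuotientGroup.ker_mk']))
  have h2 : Group.IsSolvable D := Group.isSolvable_of_comm fun a b =>
    Subtype.ext (S.commute_of_mem a.2 b.2)
  exact (Group.isSolvable_iff_subgroup_quotient D).2 ⟨h2, h1⟩

/-- Climbs the chain from A. At the bottom D ∩ A = E is trivial modulo E. For a link from B to C,
`key` shows that it is enough to have [x, d] in B: then u = [x, d] commutes with x modulo E, while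
x⁻¹u is conjugate to x⁻¹, hence a p-element, and u has order prime to p, so u is trivial modulo E.
-/
theorem commute_mod_of_chain [Finite G] (S : StructureConditions σ D M)
    {A B E : Subgroup G} [E.Normal] (hE : E = A ⊓ D)
    (hAB : Relation.ReflTransGen (SigmaSubnormalStep σ) A B) {p : ℕ} (hp : p.Prime)
    (hpD : ¬ p ∣ Nat.card D) {x : G} (hxA : x ∈ A) (hx : IsPElement p x) :
    A ≤ B ∧ ∀ d ∈ D ⊓ B, Commute (QuotientGroup.mk' E x) (QuotientGroup.mk' E d) := by
  have hDn := S.normal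
  set π := QuotientGroup.mk' E
  have hpD' : (Nat.card D).Coprime p := ((Nat.Prime.coprime_iff_not_dvd hp).2 hpD).symm
  induction hAB with
  | refl =>
    refine ⟨le_rfl, fun d hd => ?_⟩
    have : π d = 1 := (QuotientGroup.eq_one_iff d).2 (by rw [hE]; exact ⟨hd.2, hd.1⟩)
    rw [this]; exact Commute.one_right _
  | @tail B C _ hstep ih =>
    obtain ⟨hAB, ih⟩ := ih
    rw [sigmaSubnormalStep_iff] at hstep
    refine ⟨hAB.trans hstep.1, ?_⟩
    have key : ∀ d ∈ D, ⁅x, d⁆ ∈ B → Commute (π x) (π d) := by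
      intro d hd hB
      have hu : ⁅x, d⁆ ∈ D := D.mul_mem (hDn.conj_mem d hd x) (D.inv_mem hd)
      have h1 := ih _ ⟨hu, hB⟩
      have h2 : d * x⁻¹ * d⁻¹ = x⁻¹ * ⁅x, d⁆ := by rw [commutatorElement_def]; group
      have h3 : IsPElement p (π x⁻¹ * π ⁅x, d⁆) := by
        rw [← map_mul, ← h2]; exact (hx.inv.conj d).map π
      have h4 : π ⁅x, d⁆ ^ Nat.card D = 1 := by
        rw [← map_pow, pow_card_eq_one_of_mem hu, map_one]
      have h5 := (hx.inv.map π).eq_one_of_commute h3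
        (by rw [map_inv]; exact h1.inv_left) h4 hpD'
      rwa [map_commutatorElement, commutatorElement_eq_one_iff_commute] at h5
    -- If B is normal in C, then [x, d] lies in B. For a σ_l-primary link take d an r-element: if r
    -- is outside σ_l then d is already in B; if only r is in σ_l then x lies in N and so does [x,
    -- d]; if both are in σ_l the previous lemma applies.
    have hle : D ⊓ C ≤ (Subgroup.centralizer {π x}).comap π := by
      refine le_of_forall_isPElement fun r hr d hd hdr => ?_
      rw [Subgroup.mem_comap, Subgroup.mem_centralizer_singleton_iff]
      refine Commute.symm ?_
      obtain ⟨hBC, hn | ⟨l, N, hNB, hN, hl⟩⟩ := hstep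
      · refine key d hd.1 ?_
        have h2 : ⁅x, d⁆ = x * (d * x⁻¹ * d⁻¹) := by rw [commutatorElement_def]; group
        rw [h2]
        exact B.mul_mem (hAB hxA) (hn _ (B.inv_mem (hAB hxA)) d hd.2)
      · by_cases hrl : r ∈ σ l
        · by_cases hpl : p ∈ σ l
          · exact (S.commute_of_block hp hr hpl hrl hx hd.1 hdr).map π
          · have hxN := hl p hp hpl x (hBC (hAB hxA)) hx
            refine key d hd.1 (hNB ?_)
            have h2 : ⁅x, d⁆ = x * (d * x⁻¹ * d⁻¹) := by rw [commutatorElement_def]; group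
            rw [h2]
            exact N.mul_mem hxN (hN _ (N.inv_mem hxN) d hd.2)
        · exact ih d ⟨hd.1, hNB (hl r hr hrl d hd.2 hdr)⟩
    intro d hd
    exact (Subgroup.mem_centralizer_singleton_iff.1 (hle hd)).symm

theorem isModularSubgroup [Finite G] (S : StructureConditions σ D M)
    {A : Subgroup G} (hA : IsSigmaSubnormal σ A) : IsModularSubgroup A := by
  have hDn := S.normal
  have hEn : (A ⊓ D).Normal := S.normal_of_le inf_le_right
  set π := QuotientGroup.mk' (A ⊓ D) with hπ
  have hsurj : Function.Surjective π := QuotientGroup.mk'_surjective _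
  have hker : π.ker = A ⊓ D := QuotientGroup.ker_mk' _
  have hA' : A = (A.map π).comap π := by
    rw [Subgroup.comap_map_eq, hker]; exact (sup_eq_left.2 inf_le_left).symm
  rw [hA', isModularSubgroup_comap_iff hsurj]
  have hDn' : (D.map π).Normal := hDn.map π hsurj
  have hmemD : ∀ p : ℕ, p.Prime → p ∣ Nat.card D → ∀ x : G, IsPElement p x → x ∈ D :=
    fun p hp hpD x hx => hx.mem_of_index hp D fun hpi =>
      Nat.not_coprime_of_dvd_of_dvd hp.one_lt hpD hpi S.hall
  refine isModularSubgroup_of_centralizing (D := D.map π) ?_ ?_ ?_ ?_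
  · exact Nat.Coprime.of_dvd (Subgroup.card_map_dvd D π) (Subgroup.index_map_dvd D hsurj) S.hall
  · refine Nat.coprime_of_dvd fun p hp h1 h2 => ?_
    have := Fact.mk hp
    obtain ⟨⟨y, hy⟩, hyo⟩ := exists_prime_orderOf_dvd_card' p h1
    have hyp : IsPElement p (⟨y, hy⟩ : A.map π) := ⟨1, by rw [pow_one, ← hyo, pow_orderOf_eq_one]⟩
    obtain ⟨a, hap, hay⟩ := exists_isPElement_lift (π.subgroupMap_surjective A) hp hyp
    have haD := hmemD p hp (h2.trans (Subgroup.card_map_dvd D π)) a (hap.map A.subtype)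
    have ha1 : π a = 1 := by
      rw [← MonoidHom.mem_ker, hker]; exact ⟨a.2, haD⟩
    have hy1 : (⟨y, hy⟩ : A.map π) = 1 := by
      rw [← hay]; exact Subtype.ext ha1
    rw [hy1, orderOf_one] at hyo
    exact hp.ne_one hyo.symm
  · have hle : A ≤ (Subgroup.centralizer (D.map π : Set _)).comap π := by
      refine le_of_forall_isPElement fun p hp x hxA hx => ?_
      rw [Subgroup.mem_comap, Subgroup.mem_centralizer_iff]
      rintro _ ⟨d, hd, rfl⟩
      by_cases hpD : p ∣ Nat.card D
      · have hx1 : π x = 1 := by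
          rw [← MonoidHom.mem_ker, hker]; exact ⟨hxA, hmemD p hp hpD x hx⟩
        rw [hx1]; simp
      · exact ((S.commute_mod_of_chain rfl hA hp hpD hxA hx).2 d ⟨hd, trivial⟩).eq.symm
    rintro _ ⟨a, ha, rfl⟩ d hd
    exact (Subgroup.mem_centralizer_iff.1 (hle ha) d hd).symm
  · refine isModularLattice_of_surjective S.modular
      (S.surjective_comp_subtype (f := (QuotientGroup.mk' (D.map π)).comp π)
        ((QuotientGroup.mk'_surjective _).comp hsurj) fun d hd => ?_)
    exact (QuotientGroup.eq_one_iff _).2 (Subgroup.mem_map_of_mem π hd)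

theorem isMSigmaTGroup [Finite G] (S : StructureConditions σ D M) :
    IsMSigmaTGroup σ G := fun _ _ hH hK =>
  ⟨hH.1.trans hK.1, S.isModularSubgroup (hH.1.trans hK.1)⟩

end StructureConditions

end Sufficiency

/-! ### Power automorphisms of `p`-groups of order prime to `p` -/

section PowerAut

variable {P : Type*} [Group P] {p : ℕ} {α : MulAut P}

/-- Here k^m − 1 = (k − 1)s with s the geometric sum, and s ≡ m is nonzero mod p because k ≡ 1. As
x^(k^m − 1) = 1, already x^(k − 1) = 1. -/
theorem zpow_eq_self_of_coprime_order (hp : p.Prime) {m : ℕ} (hm : ¬ p ∣ m)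
    {x : P} (hx : IsPElement p x) {k : ℤ} (hk : α x = x ^ k)
    (hα : (α ^ m) x = x) (hk1 : (k : ZMod p) = 1) : α x = x := by
  have := Fact.mk hp
  obtain ⟨e, he⟩ := hx
  have hiter : ∀ n : ℕ, (α ^ n) x = x ^ (k ^ n) := by
    intro n
    induction n with
    | zero => simp
    | succ n ih => rw [pow_succ, MulAut.mul_apply, hk, map_zpow, ih, ← zpow_mul, pow_succ]
  have h1 : x ^ (k ^ m - 1) = 1 := by
    rw [zpow_sub, ← hiter, hα, zpow_one, mul_inv_cancel]
  set s := ∑ i ∈ Finset.range m, k ^ i with hs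
  have hsm : (s : ZMod p) = m := by
    rw [hs]; push_cast; rw [hk1]; simp
  have hcop : IsCoprime s ((p : ℤ) ^ e) := by
    refine IsCoprime.pow_right (IsCoprime.symm
      ((Nat.prime_iff_prime_int.1 hp).irreducible.coprime_iff_not_dvd.2 fun hd => hm ?_))
    rw [← ZMod.intCast_zmod_eq_zero_iff_dvd, hsm] at hd
    exact (ZMod.natCast_eq_zero_iff m p).1 hd
  have h2 : (x ^ (k - 1)) ^ s = 1 := by
    rw [← zpow_mul, mul_comm, hs, geom_sum_mul, h1]
  have h3 : (x ^ (k - 1)) ^ ((p : ℤ) ^ e) = 1 := by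
    rw [← zpow_mul, mul_comm, zpow_mul]
    have : x ^ ((p : ℤ) ^ e) = 1 := by exact_mod_cast he
    rw [this, one_zpow]
  obtain ⟨u, v, huv⟩ := hcop
  have h4 : x ^ (k - 1) = 1 := by
    calc x ^ (k - 1) = (x ^ (k - 1)) ^ (u * s + v * (p : ℤ) ^ e) := by rw [huv, zpow_one]
      _ = 1 := by
        rw [zpow_add, mul_comm u, mul_comm v, zpow_mul, zpow_mul, h2, h3, one_zpow, one_zpow,
          mul_one]
  rw [hk]
  rwa [zpow_sub, zpow_one, mul_inv_eq_one] at h4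

theorem zpow_eq_one_iff_cast {x : P} (hp : p.Prime) (hx : x ^ p = 1) (hx1 : x ≠ 1) {j : ℤ} :
    x ^ j = 1 ↔ (j : ZMod p) = 0 := by
  have := Fact.mk hp
  rw [← orderOf_dvd_iff_zpow_eq_one, orderOf_eq_prime hx hx1, ZMod.intCast_zmod_eq_zero_iff_dvd]

theorem IsPElement.exists_pow_prime_order {x : P} (hx : IsPElement p x) (hx1 : x ≠ 1) :
    ∃ n : ℕ, (x ^ n) ^ p = 1 ∧ x ^ n ≠ 1 := by
  classical
  have h0 : Nat.find hx ≠ 0 := by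
    intro h
    have := Nat.find_spec hx
    rw [h, pow_zero, pow_one] at this
    exact hx1 this
  obtain ⟨e, he⟩ := Nat.exists_eq_succ_of_ne_zero h0
  refine ⟨p ^ e, ?_, Nat.find_min hx (m := e) (by omega)⟩
  rw [← pow_mul, ← pow_succ]
  have := Nat.find_spec hx
  rwa [he] at this

/-- Pass to powers a, b of order p and compare with the exponent t of ab: a^(k−t) = b^(t−l). Either
both exponents vanish mod p, or a is a power of b and inherits its exponent. -/
theorem cast_eq_of_commute (hp : p.Prime) (hα : ∀ x : P, ∃ k : ℤ, α x = x ^ k) {x z : P}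
    (hx : IsPElement p x) (hz : IsPElement p z) (hx1 : x ≠ 1) (hz1 : z ≠ 1) (hxz : Commute x z)
    {k l : ℤ} (hk : α x = x ^ k) (hl : α z = z ^ l) : (k : ZMod p) = l := by
  have := Fact.mk hp
  obtain ⟨m, hm, hm1⟩ := hx.exists_pow_prime_order hx1
  obtain ⟨n, hn, hn1⟩ := hz.exists_pow_prime_order hz1
  have hk' : α (x ^ m) = (x ^ m) ^ k := by
    rw [map_pow, hk, ← zpow_natCast, ← zpow_natCast, ← zpow_mul, ← zpow_mul, mul_comm]
  have hl' : α (z ^ n) = (z ^ n) ^ l := by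
    rw [map_pow, hl, ← zpow_natCast, ← zpow_natCast, ← zpow_mul, ← zpow_mul, mul_comm]
  have hc : Commute (x ^ m) (z ^ n) := hxz.pow_pow m n
  generalize x ^ m = a at *
  generalize z ^ n = b at *
  have hsame : a ∈ Subgroup.zpowers b → (k : ZMod p) = l := by
    rintro ⟨j, rfl⟩
    simp only at hm hm1 hk'
    have h1 : (b ^ j) ^ (k - l) = 1 := by
      rw [zpow_sub, ← hk', map_zpow, hl', ← zpow_mul, ← zpow_mul, mul_comm, mul_inv_cancel]
    rw [zpow_eq_one_iff_cast hp hm hm1] at h1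
    push_cast at h1
    exact sub_eq_zero.1 h1
  obtain ⟨t, ht⟩ := hα (a * b)
  rw [hc.mul_zpow, map_mul, hk', hl'] at ht
  have h1 : a ^ (k - t) = b ^ (t - l) := by
    rw [zpow_sub, zpow_sub, eq_mul_inv_iff_mul_eq, mul_assoc,
      ((hc.zpow_left t).zpow_right l).inv_left.eq, ← mul_assoc, ht, mul_assoc,
      ← (hc.zpow_zpow t t).inv_left.eq, mul_inv_cancel_left]
  by_cases hkt : ((k - t : ℤ) : ZMod p) = 0
  · have h2 : b ^ (t - l) = 1 := by
      rw [← h1]; exact (zpow_eq_one_iff_cast hp hm hm1).2 hkt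
    rw [zpow_eq_one_iff_cast hp hn hn1] at h2
    push_cast at h2 hkt
    rw [sub_eq_zero.1 hkt, sub_eq_zero.1 h2]
  · apply hsame
    have hcop : IsCoprime (k - t) (p : ℤ) := IsCoprime.symm
      ((Nat.prime_iff_prime_int.1 hp).irreducible.coprime_iff_not_dvd.2 fun hd =>
        hkt ((ZMod.intCast_zmod_eq_zero_iff_dvd _ _).2 hd))
    obtain ⟨u, v, huv⟩ := hcop
    have h3 : a = (b ^ (t - l)) ^ u := by
      have h4 : a ^ (p : ℤ) = 1 := by exact_mod_cast hm
      calc a = a ^ (u * (k - t) + v * (p : ℤ)) := by rw [huv, zpow_one]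
        _ = (b ^ (t - l)) ^ u := by
          rw [zpow_add, mul_comm u, mul_comm v, zpow_mul, zpow_mul, h4, one_zpow, mul_one, h1]
    rw [h3]
    exact Subgroup.zpow_mem _ (Subgroup.zpow_mem _ (Subgroup.mem_zpowers b) _) _

/-- Every element commutes with a fixed nontrivial central element, which therefore determines the
exponent mod p for all of P. -/
theorem exists_cast_eq [Finite P] (hp : p.Prime) (hP : IsPGroup p P)
    (hα : ∀ x : P, ∃ k : ℤ, α x = x ^ k) :
    ∃ c : ZMod p, c ≠ 0 ∧ ∀ x : P, x ≠ 1 → ∀ k : ℤ, α x = x ^ k → (k : ZMod p) = c := by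
  have := Fact.mk hp
  cases subsingleton_or_nontrivial P
  · exact ⟨1, one_ne_zero, fun x hx => absurd (Subsingleton.elim x 1) hx⟩
  have := hP.center_nontrivial
  obtain ⟨⟨z, hz⟩, hz1⟩ := exists_ne (1 : Subgroup.center P)
  have hz1' : z ≠ 1 := fun h => hz1 (Subtype.ext h)
  obtain ⟨l, hl⟩ := hα z
  refine ⟨l, fun hl0 => ?_, fun x hx k hk =>
    cast_eq_of_commute hp hα (hP x) (hP z) hx hz1' (Subgroup.mem_center_iff.1 hz x) hk hl⟩
  obtain ⟨n, hn, hn1⟩ := IsPElement.exists_pow_prime_order (hP z) hz1'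
  have h1 : α (z ^ n) = 1 := by
    rw [map_pow, hl, ← zpow_natCast, ← zpow_mul, mul_comm, zpow_mul, zpow_natCast,
      zpow_eq_one_iff_cast hp hn hn1, hl0]
  exact hn1 (α.injective (h1.trans (map_one α).symm))

/-- A power automorphism of order prime to `p` of a `p`-group that fixes a nontrivial element
is trivial. -/
theorem powerAut_eq_one_of_fixed [Finite P] (hp : p.Prime) (hP : IsPGroup p P)
    (hα : ∀ x : P, ∃ k : ℤ, α x = x ^ k) {m : ℕ} (hm : ¬ p ∣ m) (hαm : α ^ m = 1)
    {z : P} (hz1 : z ≠ 1) (hz : α z = z) : α = 1 := by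
  obtain ⟨c, -, hc⟩ := exists_cast_eq hp hP hα
  have hc1 : (1 : ZMod p) = c := by simpa using hc z hz1 1 (by simpa using hz)
  ext x
  by_cases hx : x = 1
  · rw [hx, map_one, map_one]
  obtain ⟨k, hk⟩ := hα x
  exact zpow_eq_self_of_coprime_order hp hm (hP x) hk (by rw [hαm]; rfl)
    ((hc x hx k hk).trans hc1.symm)

theorem commutator_zpow_zpow_of_central {a b : P} (hc : ⁅a, b⁆ ∈ Subgroup.center P) (k l : ℤ) :
    ⁅a ^ k, b ^ l⁆ = ⁅a, b⁆ ^ (k * l) := by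
  rw [Subgroup.mem_center_iff] at hc
  have h1 : ∀ (a b c : P) (k : ℤ), (∀ g : P, g * c = c * g) → a * b * a⁻¹ = c * b →
      a * b ^ k * a⁻¹ = c ^ k * b ^ k := by
    intro a b c k hc h
    rw [← conj_zpow, h, Commute.mul_zpow (hc b).symm]
  have hcz : ∀ n : ℤ, ∀ g : P, g * ⁅a, b⁆ ^ n = ⁅a, b⁆ ^ n * g := fun n g =>
    ((show Commute g ⁅a, b⁆ from hc g).zpow_right n).eq
  have h2 : a * b ^ l * a⁻¹ = ⁅a, b⁆ ^ l * b ^ l := h1 a b _ l hc (by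
    rw [commutatorElement_def]; group)
  have h3 : (b ^ l)⁻¹ * a * (b ^ l)⁻¹⁻¹ = ⁅a, b⁆ ^ l * a := by
    have h4 : a * b ^ l = b ^ l * (⁅a, b⁆ ^ l * a) := by
      rw [← mul_assoc, hcz l (b ^ l), ← h2]; group
    rw [inv_inv, mul_assoc, h4, inv_mul_cancel_left]
  have h5 := h1 _ a _ k (hcz l) h3
  rw [← zpow_mul] at h5
  have h6 : a ^ k * b ^ l = b ^ l * (⁅a, b⁆ ^ (l * k) * a ^ k) := by rw [← h5]; group
  rw [commutatorElement_def (a ^ k), h6, ← mul_assoc (b ^ l), hcz, mul_comm k l]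
  group

/-- A nontrivial power automorphism of order prime to `p` exists only on abelian `p`-groups. -/
theorem commute_of_powerAut_ne_one [Finite P] (hp : p.Prime) (hP : IsPGroup p P)
    (hα : ∀ x : P, ∃ k : ℤ, α x = x ^ k) {m : ℕ} (hm : ¬ p ∣ m) (hαm : α ^ m = 1)
    (hα1 : α ≠ 1) (x y : P) : x * y = y * x := by
  have := Fact.mk hp
  by_contra hxy
  have hZ : Nontrivial (P ⧸ Subgroup.center P) := by
    by_contra hn
    rw [not_nontrivial_iff_subsingleton] at hn
    have h1 : x ∈ Subgroup.center P :=
      (QuotientGroup.eq_one_iff x).1 (Subsingleton.elim _ _)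
    exact hxy (Subgroup.mem_center_iff.1 h1 y).symm
  have := (hP.to_quotient (Subgroup.center P)).center_nontrivial
  obtain ⟨⟨a', ha'⟩, ha1⟩ := exists_ne (1 : Subgroup.center (P ⧸ Subgroup.center P))
  obtain ⟨a, rfl⟩ := QuotientGroup.mk'_surjective (Subgroup.center P) a'
  have haZ : a ∉ Subgroup.center P := fun h =>
    ha1 (Subtype.ext ((QuotientGroup.eq_one_iff a).2 h))
  have hcen : ∀ b, ⁅a, b⁆ ∈ Subgroup.center P := by
    intro b
    rw [← QuotientGroup.eq_one_iff]
    change QuotientGroup.mk' (Subgroup.center P) ⁅a, b⁆ = 1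
    rw [map_commutatorElement, commutatorElement_eq_one_iff_commute]
    exact (Subgroup.mem_center_iff.1 ha' _).symm
  obtain ⟨b, hb⟩ : ∃ b : P, ⁅a, b⁆ ≠ 1 := by
    by_contra! h
    exact haZ (Subgroup.mem_center_iff.2 fun g =>
      (commutatorElement_eq_one_iff_mul_comm.1 (h g)).symm)
  have ha : a ≠ 1 := by rintro rfl; exact haZ (Subgroup.one_mem _)
  have hb1 : b ≠ 1 := by rintro rfl; exact hb (commutatorElement_one_right a)
  obtain ⟨c, hc0, hc⟩ := exists_cast_eq hp hP hα
  obtain ⟨k, hk⟩ := hα a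
  obtain ⟨l, hl⟩ := hα b
  obtain ⟨n, hn⟩ := hα ⁅a, b⁆
  -- Since a lies in the second centre, [a, b] is central and the commutator is bimultiplicative on
  -- powers of a and b. The common exponent c mod p thus satisfies c² = c, so c = 1 and the
  -- automorphism is trivial.
  have h1 : ⁅a, b⁆ ^ (k * l - n) = 1 := by
    rw [zpow_sub, ← commutator_zpow_zpow_of_central (hcen b), ← hn, map_commutatorElement, hk, hl,
      mul_inv_cancel]
  obtain ⟨j, hj, hj1⟩ := IsPElement.exists_pow_prime_order (hP ⁅a, b⁆) hb
  have h2 : (⁅a, b⁆ ^ j) ^ (k * l - n) = 1 := by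
    rw [← zpow_natCast, ← zpow_mul, mul_comm, zpow_mul, h1, one_zpow]
  rw [zpow_eq_one_iff_cast hp hj hj1] at h2
  push_cast at h2
  rw [hc a ha k hk, hc b hb1 l hl, hc _ hb n hn] at h2
  have hc1 : c = 1 := by
    have : c * (c - 1) = 0 := by linear_combination h2
    rcases mul_eq_zero.1 this with h | h
    · exact absurd h hc0
    · exact sub_eq_zero.1 h
  apply hα1
  ext x
  by_cases hx : x = 1
  · rw [hx, map_one, map_one]
  obtain ⟨k, hk⟩ := hα x
  exact zpow_eq_self_of_coprime_order hp hm (hP x) hk (by rw [hαm]; rfl) ((hc x hx k hk).trans hc1)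

end PowerAut

/-! ### Subgroups of normal `p`-subgroups and normal Sylow subgroups -/

section NormalPSubgroups

variable {ι : Type*} {σ : ι → Set ℕ} {G : Type*} [Group G]

/-- Normalisers grow in the p-group N, so A is normal in a larger subgroup of N that is
σ-quasinormal by induction; transitivity does the rest. -/
theorem IsMSigmaTGroup.quasinormal_of_le_normal [Finite G] (hG : IsMSigmaTGroup σ G) {p : ℕ}
    (hp : p.Prime) {N : Subgroup G} [N.Normal] (hN : IsPGroup p N) (A : Subgroup G) (hA : A ≤ N) :
    IsSigmaQuasinormal σ A := by
  have := Fact.mk hp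
  induction A using WellFoundedGT.induction with
  | ind A ih =>
  by_cases hAN : A = N
  · rw [hAN]; exact isSigmaQuasinormal_of_normal N
  have hnil : Group.IsNilpotent N := hN.isNilpotent
  have hlt : A.subgroupOf N < ⊤ := lt_top_iff_ne_top.2 fun h =>
    hAN (le_antisymm hA (Subgroup.subgroupOf_eq_top.1 h))
  have h1 := Group.normalizerCondition_of_isNilpotent _ hlt
  set B' := Subgroup.normalizer (A.subgroupOf N : Set N)
  have hAB : A < B'.map N.subtype := by
    have := (Subgroup.map_lt_map_iff_of_injective N.subtype_injective).2 h1
    rwa [Subgroup.map_subgroupOf_eq_of_le hA] at this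
  refine hG.trans hAB.le ?_ (ih _ hAB (Subgroup.map_subtype_le _))
  have : (A.subgroupOf (B'.map N.subtype)).Normal := by
    rw [Subgroup.normal_subgroupOf_iff hAB.le]
    rintro a _ ha ⟨b, hb, rfl⟩
    exact (Subgroup.mem_normalizer_iff.1 hb ⟨a, hA ha⟩).1 ha
  exact isSigmaQuasinormal_of_normal _

/-- A is modular and ⟨y⟩ ∩ N = 1, so A = ⟨A, y⟩ ∩ N, which y normalises. -/
theorem IsMSigmaTGroup.conj_mem [Finite G] (hG : IsMSigmaTGroup σ G) {p q : ℕ}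
    (hp : p.Prime) (hq : q.Prime) (hpq : p ≠ q) {N : Subgroup G} [hNn : N.Normal]
    (hN : IsPGroup p N) {A : Subgroup G} (hA : A ≤ N) {y : G} (hy : IsPElement q y) {a : G}
    (ha : a ∈ A) : y * a * y⁻¹ ∈ A := by
  have h1 := (hG.quasinormal_of_le_normal hp hN A hA).2.2 (Subgroup.zpowers y) N hA
  have h2 : Subgroup.zpowers y ⊓ N = ⊥ := by
    rw [eq_bot_iff]
    rintro z ⟨hz, hzN⟩
    exact (isPElement_of_isPGroup hN hzN).eq_one_of_ne hp hq hpq (hy.mem_zpowers hz)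
  rw [h2, sup_bot_eq] at h1
  rw [h1]
  have hyB : y ∈ A ⊔ Subgroup.zpowers y := Subgroup.mem_sup_right (Subgroup.mem_zpowers y)
  exact ⟨Subgroup.mul_mem _ (Subgroup.mul_mem _ hyB (Subgroup.mem_sup_left ha))
    (Subgroup.inv_mem _ hyB), hNn.conj_mem a (hA ha) y⟩

theorem mem_normalizer_of_isPElement {A : Subgroup G} {q : ℕ} {y : G}
    (hy : IsPElement q y) (h : ∀ z : G, IsPElement q z → ∀ a ∈ A, z * a * z⁻¹ ∈ A) :
    y ∈ Subgroup.normalizer (A : Set G) := by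
  rw [Subgroup.mem_normalizer_iff]
  refine fun a => ⟨h y hy a, fun ha => ?_⟩
  simpa [mul_assoc] using h y⁻¹ hy.inv _ ha

theorem isPGroup_of_minimal_normal [Finite G] {P : Subgroup G} (hPn : P.Normal) (hPb : P ≠ ⊥)
    (hab : ∀ x ∈ P, ∀ y ∈ P, x * y = y * x)
    (hmin : ∀ N : Subgroup G, N.Normal → N ≤ P → N = ⊥ ∨ N = P) :
    ∃ r : ℕ, r.Prime ∧ ∀ x ∈ P, x ^ r = 1 := by
  obtain ⟨r, hr, hrd⟩ := Nat.exists_prime_and_dvd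
    (n := Nat.card P) (fun h => hPb (Subgroup.card_eq_one.1 h))
  have := Fact.mk hr
  let R : Subgroup G :=
    { carrier := {x | x ∈ P ∧ x ^ r = 1}
      one_mem' := ⟨P.one_mem, one_pow r⟩
      mul_mem' := by
        rintro a b ⟨ha, ha1⟩ ⟨hb, hb1⟩
        exact ⟨P.mul_mem ha hb, by
          rw [(show Commute a b from hab a ha b hb).mul_pow, ha1, hb1, one_mul]⟩
      inv_mem' := by
        rintro a ⟨ha, ha1⟩
        exact ⟨P.inv_mem ha, by rw [inv_pow, ha1, inv_one]⟩ }
  have hRn : R.Normal := by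
    constructor
    rintro n ⟨hn, hn1⟩ g
    exact ⟨hPn.conj_mem n hn g, by rw [conj_pow, hn1]; group⟩
  rcases hmin R hRn fun x hx => hx.1 with h | h
  · exfalso
    obtain ⟨x, hx⟩ := exists_prime_orderOf_dvd_card' r hrd
    have hxR : (x : G) ∈ R :=
      ⟨x.2, by rw [← hx, ← Subgroup.orderOf_coe, pow_orderOf_eq_one]⟩
    rw [h, Subgroup.mem_bot, ← orderOf_eq_one_iff, Subgroup.orderOf_coe, hx] at hxR
    exact hr.ne_one hxR
  · exact ⟨r, hr, fun x hx => by rw [← h] at hx; exact hx.2⟩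

/-- An r-group acting on a nontrivial r-group by automorphisms has a fixed point besides the
identity, by counting mod r. -/
theorem exists_mem_commute_sylow [Finite G] {r : ℕ} [hr : Fact r.Prime] (S : Sylow r G)
    {P : Subgroup G} [hPn : P.Normal] (hPb : P ≠ ⊥) (hP : IsPGroup r P) :
    ∃ w ∈ P, w ≠ 1 ∧ ∀ s ∈ S, s * w = w * s := by
  let φ : S →* MulAut P := (MulAut.conjNormal).comp (S : Subgroup G).subtype
  let _ : MulAction S P := MulAction.compHom P φ
  have hd : r ∣ Nat.card P := by
    obtain ⟨n, hn⟩ := IsPGroup.iff_card.1 hP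
    have : n ≠ 0 := by
      rintro rfl
      exact hPb (Subgroup.card_eq_one.1 (by rw [hn, pow_zero]))
    rw [hn]; exact dvd_pow_self r this
  have h1 : (1 : P) ∈ MulAction.fixedPoints S P := fun s => map_one (φ s)
  obtain ⟨w, hw, hw1⟩ := S.isPGroup'.exists_fixed_point_of_prime_dvd_card_of_fixed_point P hd h1
  refine ⟨w, w.2, fun h => hw1 (Subtype.ext h.symm), fun s hs => ?_⟩
  have h2 : s * w * s⁻¹ = w := congrArg Subtype.val (hw ⟨s, hs⟩)
  rwa [mul_inv_eq_iff_eq_mul] at h2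

theorem normal_of_normalizer [Finite G] {r : ℕ} [Fact r.Prime] (S : Sylow r G)
    {A : Subgroup G} (hS : (S : Subgroup G) ≤ Subgroup.normalizer (A : Set G))
    (h : ∀ q : ℕ, q.Prime → q ≠ r → ∀ z : G, IsPElement q z → ∀ a ∈ A, z * a * z⁻¹ ∈ A) :
    A.Normal := by
  rw [← Subgroup.normalizer_eq_top_iff, ← Subgroup.index_eq_one]
  by_contra hne
  obtain ⟨q, hq, hqd⟩ := Nat.exists_prime_and_dvd hne
  by_cases hqr : q = r
  · subst hqr
    exact S.not_dvd_index (hqd.trans (Subgroup.index_dvd_of_le hS))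
  · exact not_dvd_index_of_forall_isPElement hq
      (fun x hx => mem_normalizer_of_isPElement hx (h q hq hqr)) hqd

/-- A minimal normal subgroup is elementary abelian, for a prime r say. A nontrivial element of it
centralised by a Sylow r-subgroup spans a subgroup also normalised by all r'-elements. -/
theorem IsMSigmaTGroup.exists_normal_card_prime [Finite G] [Nontrivial G] [Group.IsSolvable G]
    (hG : IsMSigmaTGroup σ G) : ∃ W : Subgroup G, W.Normal ∧ (Nat.card W).Prime := by
  obtain ⟨P, hPn, hPb, hab, hmin⟩ := exists_minimal_normal G
  obtain ⟨r, hr, hPr⟩ := isPGroup_of_minimal_normal hPn hPb hab hmin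
  have := Fact.mk hr
  have hP : IsPGroup r P := isPGroup_of_isPElement fun x hx => ⟨1, by rw [pow_one, hPr x hx]⟩
  obtain ⟨S⟩ : Nonempty (Sylow r G) := inferInstance
  obtain ⟨w, hwP, hw1, hw⟩ := exists_mem_commute_sylow S hPb hP
  refine ⟨Subgroup.zpowers w, normal_of_normalizer S ?_ fun q hq hqr z hz a ha =>
    hG.conj_mem hr hq hqr.symm hP (by rwa [Subgroup.zpowers_le]) hz ha, ?_⟩
  · refine le_trans ?_ (Subgroup.centralizer_le_normalizer _)
    intro s hs
    rw [Subgroup.mem_centralizer_iff]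
    rintro _ ⟨n, rfl⟩
    exact ((show Commute s w from hw s hs).zpow_right n).eq.symm
  · rw [card_zpowers_of_prime hr (hPr w hwP) hw1]; exact hr

/-- In a soluble `MσT`-group the Sylow subgroup for the largest prime divisor of the order is
normal. -/
theorem IsMSigmaTGroup.sylow_normal_of_max_prime {G : Type*} [Group G] [Finite G]
    [hs : Group.IsSolvable G] (hG : IsMSigmaTGroup σ G) {p : ℕ} [hp : Fact p.Prime]
    (hmax : ∀ q : ℕ, q.Prime → q ∣ Nat.card G → q ≤ p) (S : Sylow p G) :
    (S : Subgroup G).Normal := by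
  induction hn : Nat.card G using Nat.strong_induction_on generalizing G with
  | _ n ih =>
  subst hn
  cases subsingleton_or_nontrivial G
  · rw [Subsingleton.elim (S : Subgroup G) ⊤]; infer_instance
  obtain ⟨W, hWn, hWp⟩ := hG.exists_normal_card_prime
  have hWb : W ≠ ⊥ := by
    rintro rfl
    rw [Subgroup.card_bot] at hWp
    exact hWp.ne_one rfl
  have hsurj := QuotientGroup.mk'_surjective W
  have h1 := ih _ (card_quotient_lt hWb) (hG.of_surjective hsurj)
    (fun q hq hd => hmax q hq (hd.trans W.card_quotient_dvd_card)) (S.mapSurjective hsurj) rfl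
  have h2 : ((S : Subgroup G) ⊔ W).Normal := by
    have := h1.comap (QuotientGroup.mk' W)
    rwa [Sylow.coe_mapSurjective, Subgroup.comap_map_eq, QuotientGroup.ker_mk'] at this
  by_cases hWcard : Nat.card W = p
  · have hWS : W ≤ S :=
      IsPGroup.le_sylow_of_normal (IsPGroup.of_card (n := 1) (by rw [hWcard, pow_one])) S
    rwa [sup_eq_left.2 hWS] at h2
  · have hlt : Nat.card W < p :=
      lt_of_le_of_ne (hmax _ hWp W.card_subgroup_dvd_card) hWcard
    have hWc : Fact (Nat.card W).Prime := ⟨hWp⟩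
    have hcyc : IsCyclic W := isCyclic_of_prime_card rfl
    have hSel : ∀ s ∈ (S : Subgroup G), IsPElement p s := fun s hs =>
      isPElement_of_isPGroup S.isPGroup' hs
    -- Aut W has order |W| − 1 < p, so p-elements act trivially on W.
    have hcomm : ∀ s ∈ (S : Subgroup G), ∀ w ∈ W, Commute s w := by
      intro s hs w hw
      have h3 : (MulAut.conjNormal s : MulAut W) = 1 := by
        refine ((hSel s hs).map (MulAut.conjNormal (H := W))).eq_one_of_not_dvd hp.out
          (H := ⊤) trivial fun hd => ?_
        rw [Subgroup.card_top, IsCyclic.card_mulAut, Nat.totient_prime hWp] at hd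
        have := Nat.le_of_dvd (by have := hWp.two_le; omega) hd
        omega
      have h4 := congrArg Subtype.val (DFunLike.congr_fun h3 (⟨w, hw⟩ : W))
      rw [MulAut.conjNormal_apply] at h4
      exact mul_inv_eq_iff_eq_mul.1 h4
    constructor
    intro s hs g
    -- A conjugate of s lies in the normal subgroup SW; as a p-element its component in W, which
    -- commutes with S and has order prime to p, is trivial.
    obtain ⟨t, ht, w, hw, htw⟩ := Subgroup.mem_sup_of_normal_right.1
      (h2.conj_mem s (Subgroup.mem_sup_left hs) g)
    have hw1 : w = 1 := (hSel t ht).eq_one_of_commute (by rw [htw]; exact (hSel s hs).conj g)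
      (hcomm t ht w hw) (pow_card_eq_one_of_mem hw)
      ((Nat.coprime_primes hWp hp.out).2 hWcard)
    rw [← htw, hw1, mul_one]
    exact ht

end NormalPSubgroups

/-! ### The `σ`-nilpotent residual of a soluble `MσT`-group -/

section Necessity

variable {ι : Type*} {σ : ι → Set ℕ} {G : Type*} [Group G]

/-- The properties of the `σ`-nilpotent residual that determine the structure of a soluble
`MσT`-group. -/
structure ResidualConditions (σ : ι → Set ℕ) (G : Type*) [Group G] : Prop where
  comm : ∀ a ∈ sigmaResidual σ G, ∀ b ∈ sigmaResidual σ G, Commute a b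
  hall : IsHallSubgroup (sigmaResidual σ G)
  odd : Odd (Nat.card (sigmaResidual σ G))
  normal_of_le : ∀ E ≤ sigmaResidual σ G, E.Normal
  commute_block : ∀ i, ∀ p q : ℕ, p.Prime → q.Prime → p ∈ σ i → q ∈ σ i → ∀ x : G,
    ∀ d ∈ sigmaResidual σ G, IsPElement p x → IsPElement q d → Commute x d

/-- Reduction modulo P is injective on D and maps it onto the residual of G/P. Commutators and
conjugates of elements of D stay in D, so identities modulo P hold in G. Since P contains all
p-elements, p does not divide |D|. -/
theorem residualConditions_of_inf_eq_bot [Finite G] (hσ : IsPrimePartition σ) {p : ℕ}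
    (hp : p.Prime) {P : Subgroup G} [hPn : P.Normal] (hP : IsPGroup p P) (hidx : ¬ p ∣ P.index)
    (hR : ResidualConditions σ (G ⧸ P)) (hDP : sigmaResidual σ G ⊓ P = ⊥) :
    ResidualConditions σ G := by
  have := Fact.mk hp
  have hsurj := QuotientGroup.mk'_surjective P
  have hker := QuotientGroup.ker_mk' P
  have hmap := sigmaResidual_map hσ hsurj
  have hDn : (sigmaResidual σ G).Normal := inferInstance
  set D := sigmaResidual σ G
  set f := QuotientGroup.mk' P
  have hmem : ∀ d ∈ D, f d ∈ sigmaResidual σ (G ⧸ P) := fun d hd => by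
    rw [← hmap]; exact Subgroup.mem_map_of_mem f hd
  have hone : ∀ d ∈ D, f d = 1 → d = 1 := fun d hd h => by
    rw [← Subgroup.mem_bot, ← hDP]
    exact ⟨hd, by rw [← hker]; exact h⟩
  have hcard : Nat.card D = Nat.card (sigmaResidual σ (G ⧸ P)) := by
    rw [← hmap]
    refine Nat.card_eq_of_bijective (f.subgroupMap D) ⟨?_, f.subgroupMap_surjective D⟩
    rw [injective_iff_map_eq_one]
    intro d hd
    exact Subtype.ext (hone d d.2 (congrArg Subtype.val hd))
  refine ⟨fun a ha b hb => ?_, ?_, by rw [hcard]; exact hR.odd, fun E hE => ⟨fun e he g => ?_⟩,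
    fun i p q hp hq hpi hqi x d hd hx hdq => ?_⟩
  · rw [← commutatorElement_eq_one_iff_commute]
    refine hone _ (D.mul_mem (D.mul_mem (D.mul_mem ha hb) (D.inv_mem ha)) (D.inv_mem hb)) ?_
    rw [map_commutatorElement, commutatorElement_eq_one_iff_commute]
    exact hR.comm _ (hmem a ha) _ (hmem b hb)
  · refine Nat.coprime_of_dvd fun q hq h1 h2 => ?_
    have hpD : ¬ p ∣ Nat.card D := by
      intro h
      obtain ⟨d, hd⟩ := exists_prime_orderOf_dvd_card' p h
      have hdp : IsPElement p d := ⟨1, by rw [pow_one, ← hd, pow_orderOf_eq_one]⟩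
      have h3 : (d : G) ∈ P := (hdp.map D.subtype).mem_of_index hp P hidx
      have h4 : d = 1 := Subtype.ext (hone d d.2 (by
        rw [← MonoidHom.mem_ker, hker]; exact h3))
      rw [h4, orderOf_one] at hd
      exact hp.ne_one hd.symm
    have h3 : D.relIndex (P ⊔ D) * (P ⊔ D).index = D.index :=
      Subgroup.relIndex_mul_index le_sup_right
    rw [← h3, Nat.Prime.dvd_mul hq, Subgroup.relIndex_sup_right] at h2
    rcases h2 with h2 | h2
    · obtain ⟨n, hn⟩ := IsPGroup.iff_card.1 hP
      have h4 := h2.trans (Subgroup.relIndex_dvd_card D P)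
      rw [hn] at h4
      exact hpD ((Nat.prime_dvd_prime_iff_eq hq hp).1 (hq.dvd_of_dvd_pow h4) ▸ h1)
    · have h4 := Subgroup.index_map D f
      rw [hmap, hker, MonoidHom.range_eq_top.2 hsurj, Subgroup.index_top, mul_one,
        sup_comm] at h4
      rw [← h4] at h2
      rw [hcard] at h1
      exact Nat.not_coprime_of_dvd_of_dvd hq.one_lt h1 h2 hR.hall
  · have h1 := (hR.normal_of_le (E.map f) (by
      rw [← hmap]; exact Subgroup.map_mono hE)).conj_mem (f e) (Subgroup.mem_map_of_mem f he) (f g)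
    obtain ⟨e', he', h2⟩ := h1
    have h3 : e'⁻¹ * (g * e * g⁻¹) = 1 :=
      hone _ (D.mul_mem (D.inv_mem (hE he')) (hDn.conj_mem e (hE he) g)) (by
        rw [map_mul, map_inv, h2]; simp only [map_mul, map_inv]; group)
    rw [← inv_mul_eq_one.1 h3]
    exact he'
  · rw [← commutatorElement_eq_one_iff_commute]
    refine hone _ (D.mul_mem (hDn.conj_mem d hd x) (D.inv_mem hd)) ?_
    rw [map_commutatorElement, commutatorElement_eq_one_iff_commute]
    exact hR.commute_block i p q hp hq hpi hqi _ _ (hmem d hd) (hx.map f) (hdq.map f)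

instance piClosure_characteristic (π : Set ℕ) : (piClosure π G).Characteristic := by
  rw [Subgroup.characteristic_iff_le_comap]
  intro φ
  refine (Subgroup.closure_le _).2 ?_
  rintro x ⟨q, hq, hqπ, hx⟩
  exact (hx.map φ.toMonoidHom).mem_piClosure hq hqπ

/-- L is generated by the p'-elements of E. They centralise P, which contains every p-element of G,
so p does not divide |L|. -/
theorem exists_normal_complement [Finite G] {p : ℕ} (hp : p.Prime) {P E : Subgroup G}
    [P.Normal] [E.Normal] (hidx : ¬ p ∣ P.index)
    (hE : ∀ q : ℕ, q.Prime → q ≠ p → ∀ x ∈ E, IsPElement q x → ∀ u ∈ P, Commute x u) :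
    ∃ L : Subgroup G, L.Normal ∧ ¬ p ∣ Nat.card L ∧
      ∀ q : ℕ, q.Prime → q ≠ p → ∀ x ∈ E, IsPElement q x → x ∈ L := by
  refine ⟨(piClosure {p}ᶜ E).map E.subtype, ConjAct.normal_of_characteristic_of_normal, ?_, ?_⟩
  · have h := isPiGroup_piClosure (G := E) (π := {p}ᶜ) fun q r hq hr hqp hrp x y hx hy => by
      have hrp' : r = p := by simpa using hrp
      subst hrp'
      exact Subtype.ext (hE q hq hqp x x.2 (hx.map E.subtype) y
        ((hy.map E.subtype).mem_of_index hr P hidx)).eq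
    rw [Subgroup.card_map_of_injective E.subtype_injective]
    exact fun hd => h p hp hd rfl
  · intro q hq hqp x hxE hx
    exact ⟨⟨x, hxE⟩, IsPElement.mem_piClosure
      (.of_map E.subtype E.subtype_injective hx) hq hqp, rfl⟩

/-- The p'-elements of DP give a normal p'-subgroup L with DP ≤ LP. It is enough that G/L is
σ-nilpotent, for then D ≤ L. -/
theorem sigmaResidual_inf_eq_bot [Finite G] (hσ : IsPrimePartition σ) {i : ι} {p : ℕ}
    (hp : p.Prime) (hpi : p ∈ σ i) {P : Subgroup G} [hPn : P.Normal] (hP : IsPGroup p P)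
    (hidx : ¬ p ∣ P.index)
    (hE : ∀ q : ℕ, q.Prime → q ≠ p → ∀ x ∈ sigmaResidual σ G ⊔ P, IsPElement q x →
      ∀ u ∈ P, Commute x u)
    (hout : ∀ q : ℕ, q.Prime → q ∉ σ i → ∀ x : G, IsPElement q x → ∀ u ∈ P, Commute x u) :
    sigmaResidual σ G ⊓ P = ⊥ := by
  obtain ⟨L, hLn, hLp, hL⟩ := exists_normal_complement hp hidx hE
  have hle : sigmaResidual σ G ⊔ P ≤ L ⊔ P := by
    refine le_of_forall_isPElement fun q hq x hx hxq => ?_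
    by_cases hqp : q = p
    · exact Subgroup.mem_sup_right ((hqp ▸ hxq).mem_of_index hp P hidx)
    · exact Subgroup.mem_sup_left (hL q hq hqp x hx hxq)
  -- Modulo L, [x, y] equals some u in P. The r-element x commutes with u, and x⁻¹u is conjugate to
  -- x⁻¹ modulo L; as u is a p-element with p ≠ r, it vanishes modulo L. Of two primes in different
  -- blocks at least one lies outside σ_i.
  have key : ∀ r : ℕ, r.Prime → r ∉ σ i → ∀ x y : G, IsPElement r x →
      ⁅x, y⁆ ∈ sigmaResidual σ G → ⁅x, y⁆ ∈ L := by
    intro r hr hri x y hx hxy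
    obtain ⟨l, hl, u, hu, hlu⟩ := Subgroup.mem_sup_of_normal_right.1
      (hle (Subgroup.mem_sup_left hxy))
    have h1 : QuotientGroup.mk' L ⁅x, y⁆ = QuotientGroup.mk' L u := by
      have hl1 : QuotientGroup.mk' L l = 1 := (QuotientGroup.eq_one_iff l).2 hl
      rw [← hlu, map_mul, hl1, one_mul]
    have h2 : QuotientGroup.mk' L (y * x⁻¹ * y⁻¹) =
        QuotientGroup.mk' L x⁻¹ * QuotientGroup.mk' L u := by
      rw [← h1, ← map_mul, commutatorElement_def]; congr 1; group
    obtain ⟨k, hk⟩ := isPElement_of_isPGroup hP hu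
    have h3 : QuotientGroup.mk' L u = 1 := by
      refine (hx.inv.map (QuotientGroup.mk' L)).eq_one_of_commute
        (by rw [← h2]; exact (hx.inv.conj y).map _)
        (((hout r hr hri x hx u hu).inv_left).map _)
        (n := p ^ k) (by rw [← map_pow, hk, map_one]) (Nat.Coprime.pow_left k
          ((Nat.coprime_primes hp hr).2 ?_))
      rintro rfl
      exact hri hpi
    rw [h3] at h1
    exact (QuotientGroup.eq_one_iff _).1 h1
  have hDL : sigmaResidual σ G ≤ L := by
    refine sigmaResidual_le L ((isSigmaNilpotent_quotient_iff hσ L).2 ?_)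
    intro j r s hr hs hrj hsj x y hx hy
    have hxy := commutator_mem_sigmaResidual hσ hr hs hrj hsj hx hy
    by_cases hri : r ∈ σ i
    · have hsi : s ∉ σ i := by
        rw [block_unique hσ hri hrj]; exact hsj
      have h1 := key s hs hsi y x hy (by
        rw [← commutatorElement_inv]; exact Subgroup.inv_mem _ hxy)
      rw [← commutatorElement_inv]
      exact L.inv_mem h1
    · exact key r hr hri x y hx hxy
  rw [eq_bot_iff]
  rintro x ⟨hxD, hxP⟩
  exact (isPElement_of_isPGroup hP hxP).eq_one_of_not_dvd hp (hDL hxD) hLp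

end Necessity

/-! ### The action of the group on a normal Sylow subgroup -/

section SylowAction

variable {ι : Type*} {σ : ι → Set ℕ} {G : Type*} [Group G]

theorem conjNormal_eq_one_iff {P : Subgroup G} [P.Normal] {y : G} :
    (MulAut.conjNormal y : MulAut P) = 1 ↔ ∀ u ∈ P, Commute y u := by
  constructor
  · intro h u hu
    have h4 := congrArg Subtype.val (DFunLike.congr_fun h (⟨u, hu⟩ : P))
    rw [MulAut.conjNormal_apply] at h4
    exact mul_inv_eq_iff_eq_mul.1 h4
  · intro h
    ext u
    rw [MulAut.conjNormal_apply]
    exact mul_inv_eq_iff_eq_mul.2 (h u u.2).eq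

theorem conjNormal_zpow {P : Subgroup G} [P.Normal] {y : G}
    (h : ∀ A ≤ P, ∀ a ∈ A, y * a * y⁻¹ ∈ A) (x : P) :
    ∃ k : ℤ, (MulAut.conjNormal y : MulAut P) x = x ^ k := by
  obtain ⟨k, hk⟩ := h (Subgroup.zpowers x) (by rw [Subgroup.zpowers_le]; exact x.2) x
    (Subgroup.mem_zpowers _)
  exact ⟨k, Subtype.ext (by rw [MulAut.conjNormal_apply, ← hk]; simp)⟩

/-- Conjugations by g and h act on the cyclic group ⟨u⟩ as power maps, and these commute. -/
theorem commute_commutator_of_forall_normal {P : Subgroup G} (hn : ∀ E ≤ P, E.Normal)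
    (g h : G) {u : G} (hu : u ∈ P) : Commute ⁅g, h⁆ u := by
  have hN := hn (Subgroup.zpowers u) (by rwa [Subgroup.zpowers_le])
  obtain ⟨k, hk⟩ := hN.conj_mem u (Subgroup.mem_zpowers u) g
  obtain ⟨l, hl⟩ := hN.conj_mem u (Subgroup.mem_zpowers u) h
  simp only at hk hl
  have hgh : (g * h) * u * (g * h)⁻¹ = (h * g) * u * (h * g)⁻¹ := by
    have h1 : (g * h) * u * (g * h)⁻¹ = g * (h * u * h⁻¹) * g⁻¹ := by group
    have h2 : (h * g) * u * (h * g)⁻¹ = h * (g * u * g⁻¹) * h⁻¹ := by group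
    rw [h1, h2, ← hk, ← hl, ← conj_zpow, ← conj_zpow, ← hk, ← hl, ← zpow_mul, ← zpow_mul, mul_comm]
  have h3 : ⁅g, h⁆ = g * h * (h * g)⁻¹ := by rw [commutatorElement_def]; group
  have h4 : (h * g)⁻¹ * u * (h * g) = (g * h)⁻¹ * u * (g * h) := by
    obtain ⟨v, hv⟩ : ∃ v ∈ Subgroup.zpowers u, (h * g)⁻¹ * u * (h * g) = v :=
      ⟨_, by simpa using hN.conj_mem u (Subgroup.mem_zpowers u) (h * g)⁻¹, rfl⟩
    obtain ⟨⟨j, rfl⟩, hv⟩ := hv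
    have h5 : u = ((h * g) * u * (h * g)⁻¹) ^ j := by
      simp only at hv
      rw [conj_zpow, ← hv]; group
    rw [← hgh, conj_zpow] at h5
    rw [hv]
    simp only
    conv_rhs => rw [h5]
    group
  have h5 : (g * h * (h * g)⁻¹) * u = u * (g * h * (h * g)⁻¹) := by
    calc (g * h * (h * g)⁻¹) * u = g * h * ((h * g)⁻¹ * u * (h * g)) * (h * g)⁻¹ := by group
      _ = u * (g * h * (h * g)⁻¹) := by rw [h4]; group
  rw [h3]
  exact h5

theorem IsMSigmaTGroup.commute_of_not_centralizing [Finite G] (hG : IsMSigmaTGroup σ G)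
    {p q : ℕ} (hp : p.Prime) (hq : q.Prime) (hpq : p ≠ q) {P : Subgroup G} [hPn : P.Normal]
    (hP : IsPGroup p P) {y : G} (hy : IsPElement q y)
    (hyP : ¬ ∀ u ∈ P, Commute y u) {u v : G} (hu : u ∈ P) (hv : v ∈ P) : Commute u v := by
  have hα := conjNormal_zpow (P := P) (y := y) fun A hA a ha =>
    hG.conj_mem hp hq hpq hP hA hy ha
  obtain ⟨k, hk⟩ := hy
  have hm : ¬ p ∣ q ^ k := fun h =>
    hpq ((Nat.prime_dvd_prime_iff_eq hp hq).1 (hp.dvd_of_dvd_pow h))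
  exact congrArg Subtype.val (commute_of_powerAut_ne_one hp hP hα hm
    (by rw [← map_pow, hk, map_one]) (fun h => hyP (conjNormal_eq_one_iff.1 h)) ⟨u, hu⟩ ⟨v, hv⟩)

theorem IsMSigmaTGroup.normal_of_le_sylow [Finite G] (hG : IsMSigmaTGroup σ G)
    {p : ℕ} (hp : p.Prime) {P : Subgroup G} [hPn : P.Normal] (hP : IsPGroup p P)
    (hidx : ¬ p ∣ P.index) (hab : ∀ u ∈ P, ∀ v ∈ P, Commute u v) {E : Subgroup G} (hE : E ≤ P) :
    E.Normal := by
  have := Fact.mk hp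
  refine normal_of_normalizer (hP.toSylow hidx) ?_ fun q hq hqp z hz a ha =>
    hG.conj_mem hp hq hqp.symm hP hE hz ha
  refine le_trans ?_ (Subgroup.centralizer_le_normalizer _)
  intro u hu
  rw [Subgroup.mem_centralizer_iff]
  exact fun e he => (hab e (hE he) u hu).eq

/-- All commutators of G centralise P, so G modulo the centraliser of P is abelian, in particular
σ-nilpotent. -/
theorem sigmaResidual_commute_of_forall_normal [Finite G] (hσ : IsPrimePartition σ)
    {P : Subgroup G} [P.Normal] (hn : ∀ E ≤ P, E.Normal) {d u : G} (hd : d ∈ sigmaResidual σ G)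
    (hu : u ∈ P) : Commute d u := by
  have hle : sigmaResidual σ G ≤ Subgroup.centralizer (P : Set G) := by
    refine sigmaResidual_le _ ((isSigmaNilpotent_quotient_iff hσ _).2 ?_)
    intro i p q _ _ _ _ x y _ _ u hu
    exact (commute_commutator_of_forall_normal hn x y hu).eq.symm
  exact (Subgroup.mem_centralizer_iff.1 (hle hd) u hu).symm

/-- The power automorphism induced by y is nontrivial of order prime to p, so it has no nontrivial
fixed point. Then v ↦ [v, y] is injective, hence onto P, and its values lie in the residual because
p and q are in different blocks. -/
theorem IsMSigmaTGroup.le_sigmaResidual [Finite G] (hσ : IsPrimePartition σ)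
    (hG : IsMSigmaTGroup σ G) {i : ι} {p q : ℕ} (hp : p.Prime) (hq : q.Prime) (hpi : p ∈ σ i)
    (hqi : q ∉ σ i) {P : Subgroup G} [hPn : P.Normal] (hP : IsPGroup p P) {y : G}
    (hy : IsPElement q y) (hyP : ¬ ∀ u ∈ P, Commute y u) : P ≤ sigmaResidual σ G := by
  have hpq : p ≠ q := by rintro rfl; exact hqi hpi
  have hα := conjNormal_zpow (P := P) (y := y) fun A hA a ha =>
    hG.conj_mem hp hq hpq hP hA hy ha
  set α : MulAut P := MulAut.conjNormal y with hαdef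
  have hα1 : α ≠ 1 := fun h => hyP (conjNormal_eq_one_iff.1 h)
  obtain ⟨k, hk⟩ := id hy
  have hm : ¬ p ∣ q ^ k := fun h =>
    hpq ((Nat.prime_dvd_prime_iff_eq hp hq).1 (hp.dvd_of_dvd_pow h))
  have hinj : Function.Injective fun v : P => v * (α v)⁻¹ := by
    intro v w hvw
    by_contra hne
    have h1 : w⁻¹ * v ≠ 1 := fun h => hne (inv_mul_eq_one.1 h).symm
    refine hα1 (powerAut_eq_one_of_fixed hp hP hα hm (by rw [hαdef, ← map_pow, hk, map_one]) h1 ?_)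
    have h2 : v * (α v)⁻¹ = w * (α w)⁻¹ := hvw
    have h3 : v = w * (α w)⁻¹ * α v := mul_inv_eq_iff_eq_mul.1 h2
    rw [map_mul, map_inv, eq_inv_mul_iff_mul_eq, ← mul_assoc, ← h3]
  intro u hu
  obtain ⟨v, hv⟩ := Finite.surjective_of_injective hinj ⟨u, hu⟩
  have h1 : u = ⁅(v : G), y⁆ := by
    have h2 := congrArg Subtype.val hv
    simp only [Subgroup.coe_mul, Subgroup.coe_inv, hαdef, MulAut.conjNormal_apply] at h2
    rw [← h2, commutatorElement_def]; group
  rw [h1]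
  exact commutator_mem_sigmaResidual hσ hp hq hpi hqi (isPElement_of_isPGroup hP v.2) hy

/-- Here |D| = |P| · |DP/P| and the index of D is unchanged modulo P, which gives the Hall and
parity conditions. The other properties are checked on elements of prime power order: p-elements lie
in P, and for other primes the error terms lie in P, which D centralises. -/
theorem residualConditions_of_le [Finite G] (hσ : IsPrimePartition σ) {i : ι} {p : ℕ}
    (hp : p.Prime) (hpi : p ∈ σ i) (hodd : p ≠ 2) {P : Subgroup G} [hPn : P.Normal]
    (hP : IsPGroup p P) (hidx : ¬ p ∣ P.index) (hn : ∀ E ≤ P, E.Normal)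
    (hPD : P ≤ sigmaResidual σ G)
    (hstar : ∀ q : ℕ, q.Prime → q ∈ σ i → ∀ x : G, IsPElement q x → ∀ u ∈ P, Commute x u)
    (hR : ResidualConditions σ (G ⧸ P)) : ResidualConditions σ G := by
  have := Fact.mk hp
  have hsurj := QuotientGroup.mk'_surjective P
  have hker := QuotientGroup.ker_mk' P
  have hmap := sigmaResidual_map hσ hsurj
  have hDn : (sigmaResidual σ G).Normal := inferInstance
  have hcen : ∀ d ∈ sigmaResidual σ G, ∀ u ∈ P, Commute d u := fun d hd u hu =>
    sigmaResidual_commute_of_forall_normal hσ hn hd hu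
  set D := sigmaResidual σ G
  set f := QuotientGroup.mk' P
  have hmem : ∀ d ∈ D, f d ∈ sigmaResidual σ (G ⧸ P) := fun d hd => by
    rw [← hmap]; exact Subgroup.mem_map_of_mem f hd
  have hpmem : ∀ x : G, IsPElement p x → x ∈ P := fun x hx => hx.mem_of_index hp P hidx
  have hPel : ∀ {u : G}, u ∈ P → IsPElement p u := fun hu => isPElement_of_isPGroup hP hu
  -- The lifting device from G/P: if b and bu are both q-elements with q ≠ p and b commutes with u
  -- in P, the error u is trivial.
  have hPone : ∀ {q : ℕ} {b u : G}, q.Prime → q ≠ p → IsPElement q b → IsPElement q (b * u) →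
      Commute b u → u ∈ P → u = 1 := by
    intro q b u hq hqp hb hbu hc hu
    obtain ⟨k, hk⟩ := hPel hu
    exact hb.eq_one_of_commute hbu hc hk
      (Nat.Coprime.pow_left k ((Nat.coprime_primes hp hq).2 hqp.symm))
  have hcard : Nat.card D = Nat.card (sigmaResidual σ (G ⧸ P)) * Nat.card P := by
    have h1 : Nat.card P * P.relIndex D = Nat.card D := by
      rw [← Subgroup.relIndex_bot_left, ← Subgroup.relIndex_bot_left]
      exact Subgroup.relIndex_mul_relIndex _ _ _ bot_le hPD
    have h2 : P.relIndex D = Nat.card (D.map f) := by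
      rw [← Subgroup.relIndex_ker, hker]
    rw [← h1, h2, hmap, mul_comm]
  have hindex : D.index = (sigmaResidual σ (G ⧸ P)).index := by
    rw [← hmap, Subgroup.index_map, hker, MonoidHom.range_eq_top.2 hsurj, Subgroup.index_top,
      mul_one, sup_eq_left.2 hPD]
  have hpP : ∀ q : ℕ, q.Prime → q ∣ Nat.card P → q = p := by
    intro q hq hd
    obtain ⟨n, hn⟩ := IsPGroup.iff_card.1 hP
    rw [hn] at hd
    exact (Nat.prime_dvd_prime_iff_eq hq hp).1 (hq.dvd_of_dvd_pow hd)
  have hcomm : ∀ q r : ℕ, q.Prime → r.Prime → ∀ a ∈ D, ∀ b ∈ D, IsPElement q a →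
      IsPElement r b → Commute a b := by
    intro q r hq hr a ha b hb haq hbr
    by_cases hqp : q = p
    · exact (hcen b hb a (hpmem a (hqp ▸ haq))).symm
    by_cases hrp : r = p
    · exact hcen a ha b (hpmem b (hrp ▸ hbr))
    have hu : ⁅a, b⁆ ∈ P := by
      rw [← hker, MonoidHom.mem_ker, map_commutatorElement, commutatorElement_eq_one_iff_commute]
      exact hR.comm _ (hmem a ha) _ (hmem b hb)
    have h1 := (hcen b hb _ hu)
    rw [← commutatorElement_eq_one_iff_commute]
    refine hPone hr hrp hbr ?_ h1 hu
    rw [h1.eq, commutatorElement_def]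
    have : a * b * a⁻¹ * b⁻¹ * b = a * b * a⁻¹ := by group
    rw [this]
    exact hbr.conj a
  have hnormal : ∀ E ≤ D, E.Normal := by
    intro E hE
    constructor
    intro e he g
    have hle : E ≤ E.comap (MulAut.conj g).toMonoidHom := by
      refine le_of_forall_isPElement fun q hq e he heq => ?_
      change g * e * g⁻¹ ∈ E
      by_cases hqp : q = p
      · have h1 := (hn (Subgroup.zpowers e) (by
          rw [Subgroup.zpowers_le]; exact hpmem e (hqp ▸ heq))).conj_mem e
            (Subgroup.mem_zpowers e) g
        exact (Subgroup.zpowers_le.2 he) h1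
      · obtain ⟨_, ⟨m, rfl⟩, hm⟩ : ∃ e' ∈ Subgroup.zpowers e, f e' = f (g * e * g⁻¹) := by
          have h1 := (hR.normal_of_le ((Subgroup.zpowers e).map f) (by
            rw [← hmap]
            exact Subgroup.map_mono ((Subgroup.zpowers_le.2 he).trans hE))).conj_mem (f e)
              (Subgroup.mem_map_of_mem f (Subgroup.mem_zpowers e)) (f g)
          obtain ⟨e', he', h⟩ := h1
          exact ⟨e', he', by rw [h]; simp only [map_mul, map_inv]⟩
        have hu : (e ^ m)⁻¹ * (g * e * g⁻¹) ∈ P := QuotientGroup.eq.1 hm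
        have h2 := hPone hq hqp (heq.zpow m) (by
          rw [mul_inv_cancel_left]; exact heq.conj g) (hcen _ (D.zpow_mem (hE he) m) _ hu) hu
        rw [← inv_mul_eq_one.1 h2]
        exact E.zpow_mem he m
    exact hle he
  refine ⟨?_, ?_, ?_, hnormal, ?_⟩
  · intro a ha b hb
    have h1 : ∀ r : ℕ, r.Prime → ∀ b ∈ D, IsPElement r b → ∀ a ∈ D, Commute a b := by
      intro r hr b hb hbr
      have hle : D ≤ Subgroup.centralizer {b} := by
        refine le_of_forall_isPElement fun q hq a ha haq => ?_
        rw [Subgroup.mem_centralizer_singleton_iff]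
        exact hcomm q r hq hr a ha b hb haq hbr
      exact fun a ha => Subgroup.mem_centralizer_singleton_iff.1 (hle ha)
    have hle : D ≤ Subgroup.centralizer {a} := by
      refine le_of_forall_isPElement fun r hr b hb hbr => ?_
      rw [Subgroup.mem_centralizer_singleton_iff]
      exact (h1 r hr b hb hbr a ha).symm
    exact (show Commute b a from Subgroup.mem_centralizer_singleton_iff.1 (hle hb)).symm
  · change (Nat.card D).Coprime D.index
    rw [hcard]
    refine Nat.Coprime.mul_left (hindex ▸ hR.hall) (Nat.coprime_of_dvd fun q hq h1 h2 => ?_)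
    rw [hpP q hq h1] at h2
    exact hidx (h2.trans (Subgroup.index_dvd_of_le hPD))
  · rw [hcard]
    refine hR.odd.mul ?_
    obtain ⟨n, hn⟩ := IsPGroup.iff_card.1 hP
    rw [hn]
    exact (hp.odd_of_ne_two hodd).pow
  · intro j s q hs hq hsj hqj x d hd hx hdq
    by_cases hqp : q = p
    · subst hqp
      have hij : i = j := block_unique hσ hpi hqj
      exact hstar s hs (hij ▸ hsj) x hx d (hpmem d hdq)
    -- The commutator lies in P by the quotient and in ⟨d⟩ by normality, and these intersect
    -- trivially.
    · have hu : ⁅x, d⁆ ∈ P := by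
        rw [← hker, MonoidHom.mem_ker, map_commutatorElement, commutatorElement_eq_one_iff_commute]
        exact hR.commute_block j s q hs hq hsj hqj _ _ (hmem d hd) (hx.map f) (hdq.map f)
      have h1 := (hnormal (Subgroup.zpowers d) (by rwa [Subgroup.zpowers_le]))
      have h2 : ⁅x, d⁆ ∈ Subgroup.zpowers d :=
        Subgroup.mul_mem _ (h1.conj_mem d (Subgroup.mem_zpowers d) x)
          (Subgroup.inv_mem _ (Subgroup.mem_zpowers d))
      rw [← commutatorElement_eq_one_iff_commute]
      exact (hdq.mem_zpowers h2).eq_one_of_ne hq hp hqp (hPel hu)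

end SylowAction

/-! ### The inductive proof of the residual conditions -/

section Induction

variable {ι : Type*} {σ : ι → Set ℕ} {G : Type*} [Group G]

theorem card_sup_dvd_mul [Finite G] (K N : Subgroup G) [N.Normal] :
    Nat.card (K ⊔ N : Subgroup G) ∣ Nat.card N * Nat.card K := by
  have h1 : Nat.card N * N.relIndex (K ⊔ N) = Nat.card (K ⊔ N : Subgroup G) := by
    rw [← Subgroup.relIndex_bot_left, ← Subgroup.relIndex_bot_left]
    exact Subgroup.relIndex_mul_relIndex _ _ _ bot_le le_sup_right
  rw [← h1, Subgroup.relIndex_sup_right]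
  exact mul_dvd_mul_left _ (Subgroup.relIndex_dvd_card N K)

/-- Proper nontrivial subgroups have prime order, so a strict X < Z forces X = 1 or Z = G. -/
theorem isModularLattice_of_card_dvd [Finite G] {p q : ℕ} (hp : p.Prime) (hq : q.Prime)
    (h : Nat.card G ∣ p * q) : IsModularLattice (Subgroup G) := by
  refine ⟨fun {X} Y Z hXZ => ?_⟩
  by_cases hX : X = ⊥
  · rw [hX]; simp
  by_cases hZ : Z = ⊤
  · rw [hZ]; simp
  have hZp : (Nat.card Z).Prime := by
    obtain ⟨a, b, ha, hb, hab⟩ := (Nat.dvd_mul).1 (Z.card_subgroup_dvd_card.trans h)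
    have hZ1 : Nat.card Z ≠ 1 := fun h1 => hX (by
      rw [Subgroup.card_eq_one.1 h1] at hXZ; exact le_bot_iff.1 hXZ)
    rcases (Nat.dvd_prime hp).1 ha with rfl | rfl <;> rcases (Nat.dvd_prime hq).1 hb with rfl | rfl
    · exact absurd (by rw [← hab]) hZ1
    · rw [← hab, one_mul]; exact hq
    · rw [← hab, mul_one]; exact hp
    · exact absurd (Subgroup.eq_top_of_card_eq Z (Nat.dvd_antisymm Z.card_subgroup_dvd_card
        (hab ▸ h))) hZ
  rcases eq_bot_or_eq_of_card_prime hZp hXZ with h1 | h1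
  · exact absurd h1 hX
  · rw [h1]; exact inf_le_right.trans le_sup_left

/-- A soluble `MσT`-group with a self-centralizing normal Sylow subgroup `P` of prime order
`p ∈ σ i`: if a further prime `s ∈ σ i` divides `|G|`, then `|G : P| = s`. -/
theorem IsMSigmaTGroup.index_eq_of_self_centralizing [Finite G] (hG : IsMSigmaTGroup σ G) {i : ι}
    {p s : ℕ} (hp : p.Prime) (hs : s.Prime) (hpi : p ∈ σ i) (hsi : s ∈ σ i)
    {P : Subgroup G} [hPn : P.Normal] (hP : Nat.card P = p) (hidx : ¬ p ∣ P.index)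
    (hcomm : ∀ g h : G, ⁅g, h⁆ ∈ P) (hself : ∀ g : G, (∀ u ∈ P, Commute g u) → g ∈ P)
    (hsG : s ∣ P.index) : P.index = s := by
  have := Fact.mk hs
  have hPp : (Nat.card P).Prime := hP ▸ hp
  obtain ⟨Q, hQ⟩ := Subgroup.exists_right_complement'_of_coprime (N := P)
    (by rw [hP]; exact (Nat.Prime.coprime_iff_not_dvd hp).2 hidx)
  have hQi : P.index = Nat.card Q := hQ.symm.index_eq_card
  rw [hQi] at hsG ⊢
  obtain ⟨⟨h, hhQ⟩, hh⟩ := exists_prime_orderOf_dvd_card' s hsG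
  replace hh : orderOf h = s := by rw [← hh, Subgroup.orderOf_mk]
  have hinf : ∀ g, g ∈ P → g ∈ Q → g = 1 := fun g h1 h2 =>
    Subgroup.mem_bot.1 (by rw [← disjoint_iff.1 hQ.disjoint]; exact ⟨h1, h2⟩)
  have hhP : h ∉ P := fun h1 => by
    rw [hinf h h1 hhQ, orderOf_one] at hh
    exact hs.ne_one hh.symm
  have hHQ : Subgroup.zpowers h ≤ Q := by rwa [Subgroup.zpowers_le]
  have hHcard : Nat.card (Subgroup.zpowers h) = s := by rw [Nat.card_zpowers, hh]
  have hKn : (Subgroup.zpowers h ⊔ P).Normal := by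
    constructor
    intro k hk g
    have : g * k * g⁻¹ = ⁅g, k⁆ * k := by rw [commutatorElement_def]; group
    rw [this]
    exact Subgroup.mul_mem _ (Subgroup.mem_sup_right (hcomm g k)) hk
  have hKcard : Nat.card (Subgroup.zpowers h ⊔ P : Subgroup G) ∣ p * s := by
    have := card_sup_dvd_mul (Subgroup.zpowers h) P
    rwa [hP, hHcard] at this
  -- The normal subgroup ⟨h⟩P has order dividing ps: its lattice is modular and it is a σ_i-group,
  -- so ⟨h⟩ is σ-quasinormal in it, hence in G.
  have hHK : IsSigmaQuasinormal σ
      ((Subgroup.zpowers h).subgroupOf (Subgroup.zpowers h ⊔ P)) := by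
    refine ⟨Relation.ReflTransGen.single ⟨le_top, Or.inr ⟨i, fun q hq hqd => ?_⟩⟩,
      isModularLattice_iff.1 (isModularLattice_of_card_dvd hp hs hKcard) _⟩
    have h1 := hqd.trans (Subgroup.card_quotient_dvd_card _)
    rw [Subgroup.card_top] at h1
    rcases (Nat.Prime.dvd_mul hq).1 (h1.trans hKcard) with h2 | h2
    · rwa [(Nat.prime_dvd_prime_iff_eq hq hp).1 h2]
    · rwa [(Nat.prime_dvd_prime_iff_eq hq hs).1 h2]
  have hH := hG.trans le_sup_left hHK (isSigmaQuasinormal_of_normal _)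
  obtain ⟨u, huP, hu⟩ : ∃ u ∈ P, ¬ Commute h u := by
    by_contra! hc
    exact hhP (hself h hc)
  have hu1 : u ≠ 1 := by rintro rfl; exact hu (Commute.one_right h)
  have hzp : ∀ v ∈ P, v ≠ 1 → Subgroup.zpowers v = P := by
    intro v hv hv1
    rcases eq_bot_or_eq_of_card_prime hPp (Subgroup.zpowers_le.2 hv) with h1 | h1
    · exact absurd (Subgroup.zpowers_eq_bot.1 h1) hv1
    · exact h1
  -- Apply the modular law to ⟨h⟩ ≤ Q and the conjugate of Q by u. That conjugate meets Q trivially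
  -- and generates G together with h, so the law reads ⟨h⟩ = Q.
  have hmod := hH.2.2 (Q.map (MulAut.conj u).toMonoidHom) Q hHQ
  have h1 : Q.map (MulAut.conj u).toMonoidHom ⊓ Q = ⊥ := by
    rw [eq_bot_iff]
    rintro z ⟨⟨w, hw, hwz⟩, hz⟩
    replace hwz : u * w * u⁻¹ = z := hwz
    have h2 : z * w⁻¹ = 1 := by
      refine hinf _ ?_ (Q.mul_mem hz (Q.inv_mem hw))
      have : z * w⁻¹ = u * (w * u⁻¹ * w⁻¹) := by rw [← hwz]; group
      rw [this]
      exact P.mul_mem huP (hPn.conj_mem _ (P.inv_mem huP) w)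
    have h3 : z = w := mul_inv_eq_one.1 h2
    have h4 : Commute z u := by
      rw [← h3, mul_inv_eq_iff_eq_mul] at hwz
      exact hwz.symm
    refine Subgroup.mem_bot.2 (hinf z (hself z fun v hv => ?_) hz)
    rw [← hzp u huP hu1] at hv
    obtain ⟨n, rfl⟩ := hv
    exact h4.zpow_right n
  have h2 : Subgroup.zpowers h ⊔ Q.map (MulAut.conj u).toMonoidHom = ⊤ := by
    have h3 : ⁅u, h⁆ ∈ Subgroup.zpowers h ⊔ Q.map (MulAut.conj u).toMonoidHom :=
      Subgroup.mul_mem _ (Subgroup.mem_sup_right ⟨h, hhQ, rfl⟩)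
        (Subgroup.mem_sup_left (Subgroup.inv_mem _ (Subgroup.mem_zpowers h)))
    have h4 : P ≤ Subgroup.zpowers h ⊔ Q.map (MulAut.conj u).toMonoidHom := by
      rw [← hzp _ (hcomm u h) fun h5 => hu (commutatorElement_eq_one_iff_commute.1 h5).symm,
        Subgroup.zpowers_le]
      exact h3
    rw [eq_top_iff, ← hQ.sup_eq_top]
    refine sup_le h4 fun w hw => ?_
    have h5 : w = u⁻¹ * (u * w * u⁻¹) * u := by group
    rw [h5]
    exact Subgroup.mul_mem _ (Subgroup.mul_mem _ (Subgroup.inv_mem _ (h4 huP))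
      (Subgroup.mem_sup_right ⟨w, hw, rfl⟩)) (h4 huP)
  rw [h1, h2, sup_bot_eq, top_inf_eq] at hmod
  rw [← hmod, hHcard]

/-- If x moves P, then P lies in every nontrivial normal subgroup, has order p and is
self-centralising. Its index is then the prime s, yet t divides it, although t is outside the block
of s. -/
theorem IsMSigmaTGroup.commute_of_block [Finite G] (hσ : IsPrimePartition σ)
    (hG : IsMSigmaTGroup σ G) {i : ι} {p s t : ℕ} (hp : p.Prime) (hs : s.Prime) (ht : t.Prime)
    (hpi : p ∈ σ i) (hsi : s ∈ σ i) (hti : t ∉ σ i) {P : Subgroup G} [hPn : P.Normal]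
    (hP : IsPGroup p P) (hidx : ¬ p ∣ P.index) (hab : ∀ u ∈ P, ∀ v ∈ P, Commute u v)
    (hn : ∀ E ≤ P, E.Normal) (hPD : P ≤ sigmaResidual σ G)
    (hR : ∀ N : Subgroup G, ∀ _ : N.Normal, N ≠ ⊥ → ResidualConditions σ (G ⧸ N))
    {y : G} (hy : IsPElement t y) (hyP : ¬ ∀ u ∈ P, Commute y u)
    {x : G} (hx : IsPElement s x) : ∀ u ∈ P, Commute x u := by
  have := Fact.mk hp
  by_contra hxP
  have hsp : s ≠ p := by
    rintro rfl
    exact hxP fun u hu => hab x (hx.mem_of_index hs P hidx) u hu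
  have htp : t ≠ p := by rintro rfl; exact hti hpi
  have hpel : ∀ {u : G}, u ∈ P → IsPElement p u := fun hu => isPElement_of_isPGroup hP hu
  have hα := conjNormal_zpow (P := P) (y := x) fun A hA a ha => (hn A hA).conj_mem a ha x
  have hα1 : (MulAut.conjNormal x : MulAut P) ≠ 1 := fun h => hxP (conjNormal_eq_one_iff.1 h)
  -- If u is in P but not in N, then x commutes with u modulo N by the inductive hypothesis, so
  -- u^(k−1) lies in N, where x acts on u as the power k. Hence p divides k − 1, and x fixes a power
  -- of u of order p; this makes its action on P trivial.
  have hle : ∀ N : Subgroup G, N.Normal → N ≠ ⊥ → P ≤ N := by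
    intro N hNn hNb u hu
    by_contra huN
    have hRN := hR N hNn hNb
    have hsurj := QuotientGroup.mk'_surjective N
    have h1 : Commute (QuotientGroup.mk' N x) (QuotientGroup.mk' N u) :=
      hRN.commute_block i s p hs hp hsi hpi _ _
        (by rw [← sigmaResidual_map hσ hsurj]; exact Subgroup.mem_map_of_mem _ (hPD hu))
        (hx.map _) ((hpel hu).map _)
    have h2 : x * u * x⁻¹ * u⁻¹ ∈ N := by
      rw [← commutatorElement_def, ← QuotientGroup.eq_one_iff]
      change QuotientGroup.mk' N ⁅x, u⁆ = 1
      rw [map_commutatorElement, commutatorElement_eq_one_iff_commute]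
      exact h1
    obtain ⟨k, hk⟩ := hα ⟨u, hu⟩
    have hk' : x * u * x⁻¹ = u ^ k := by
      have := congrArg Subtype.val hk
      rwa [MulAut.conjNormal_apply] at this
    have h3 : u ^ (k - 1) ∈ N := by
      rw [zpow_sub, zpow_one, ← hk']; exact h2
    have h4 : ((k - 1 : ℤ) : ZMod p) = 0 := by
      by_contra hne
      obtain ⟨e, he⟩ := hpel hu
      have hcop : IsCoprime (k - 1) ((p : ℤ) ^ e) := (IsCoprime.symm
        ((Nat.prime_iff_prime_int.1 hp).irreducible.coprime_iff_not_dvd.2 fun hd =>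
          hne ((ZMod.intCast_zmod_eq_zero_iff_dvd _ _).2 hd))).pow_right
      obtain ⟨a, b, hab⟩ := hcop
      apply huN
      have h5 : u ^ ((p : ℤ) ^ e) = 1 := by exact_mod_cast he
      have h6 : u = (u ^ (k - 1)) ^ a := by
        calc u = u ^ (a * (k - 1) + b * (p : ℤ) ^ e) := by rw [hab, zpow_one]
          _ = _ := by rw [zpow_add, mul_comm a, mul_comm b, zpow_mul, zpow_mul, h5, one_zpow,
            mul_one]
      rw [h6]
      exact N.zpow_mem h3 a
    have hu1 : u ≠ 1 := by rintro rfl; exact huN N.one_mem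
    obtain ⟨n, hn1, hn2⟩ := (hpel hu).exists_pow_prime_order hu1
    have h5 : (u ^ n) ^ (k - 1) = 1 := (zpow_eq_one_iff_cast hp hn1 hn2).2 h4
    have hxm : ∃ m, x ^ s ^ m = 1 := hx
    obtain ⟨m, hm⟩ := hxm
    refine hα1 (powerAut_eq_one_of_fixed hp hP hα (m := s ^ m)
      (fun h => hsp ((Nat.prime_dvd_prime_iff_eq hp hs).1 (hp.dvd_of_dvd_pow h)).symm)
      (by rw [← map_pow, hm, map_one]) (z := ⟨u, hu⟩ ^ n)
      (fun h => hn2 (congrArg Subtype.val h)) ?_)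
    rw [map_pow, hk]
    refine Subtype.ext ?_
    change (u ^ k) ^ n = u ^ n
    rw [zpow_sub, zpow_one, mul_inv_eq_one] at h5
    rw [← h5, ← zpow_natCast, ← zpow_natCast, ← zpow_mul, ← zpow_mul, mul_comm]
  obtain ⟨u, huP, hu1⟩ : ∃ u ∈ P, u ≠ 1 := by
    by_contra! hc
    exact hxP fun u hu => by rw [hc u hu]; exact Commute.one_right x
  obtain ⟨n, hn1, hn2⟩ := (hpel huP).exists_pow_prime_order hu1
  have hzP : Subgroup.zpowers (u ^ n) ≤ P := by
    rw [Subgroup.zpowers_le]; exact P.pow_mem huP n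
  have hPcard : Nat.card P = p := by
    have h1 : P = Subgroup.zpowers (u ^ n) := le_antisymm
      (hle _ (hn _ hzP) fun h => hn2 (Subgroup.zpowers_eq_bot.1 h)) hzP
    rw [h1, card_zpowers_of_prime hp hn1 hn2]
  have hself : ∀ g : G, (∀ u ∈ P, Commute g u) → g ∈ P := by
    have hCn : (Subgroup.centralizer (P : Set G)).Normal := inferInstance
    obtain ⟨L, hLn, hLp, hL⟩ := exists_normal_complement hp (P := P)
      (E := Subgroup.centralizer (P : Set G)) hidx fun q _ _ x hx _ u hu =>
        (Subgroup.mem_centralizer_iff.1 hx u hu).symm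
    -- A nontrivial normal subgroup contains P, but p does not divide |L|.
    have hLb : L = ⊥ := by
      by_contra hne
      exact hLp (hPcard ▸ Subgroup.card_dvd_of_le (hle L hLn hne))
    have hCP : Subgroup.centralizer (P : Set G) ≤ P := by
      refine le_of_forall_isPElement fun q hq z hz hzq => ?_
      by_cases hqp : q = p
      · exact (hqp ▸ hzq).mem_of_index hp P hidx
      · have := hL q hq hqp z hz hzq
        rw [hLb, Subgroup.mem_bot] at this
        rw [this]; exact P.one_mem
    exact fun g hg => hCP (Subgroup.mem_centralizer_iff.2 fun u hu => (hg u hu).eq.symm)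
  have hdvd : ∀ q : ℕ, q.Prime → q ≠ p → ∀ z : G, IsPElement q z → (¬ ∀ u ∈ P, Commute z u) →
      q ∣ P.index := by
    intro q hq hqp z hz hzP
    have h1 : q ∣ Nat.card G := by
      rw [← Subgroup.card_top]
      refine hz.dvd_card hq ?_ (Subgroup.mem_top z)
      rintro rfl
      exact hzP fun u _ => Commute.one_left u
    rw [← P.card_mul_index, hPcard] at h1
    exact ((Nat.Prime.dvd_mul hq).1 h1).resolve_left fun h =>
      hqp ((Nat.prime_dvd_prime_iff_eq hq hp).1 h)
  have hs' := hG.index_eq_of_self_centralizing hp hs hpi hsi hPcard hidx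
    (fun g h => hself _ fun u hu => commute_commutator_of_forall_normal hn g h hu) hself
    (hdvd s hs hsp x hx hxP)
  have ht' := hdvd t ht htp y hy hyP
  rw [hs'] at ht'
  exact hti ((Nat.prime_dvd_prime_iff_eq ht hs).1 ht' ▸ hsi)

/-- Induction on the order, factoring out the normal Sylow subgroup P for the largest prime p in
σ_i. The case division is whether every σ_i'-element of prime power order centralises P. -/
theorem IsMSigmaTGroup.residualConditions {G : Type*} [Group G] [Finite G]
    [hsol : Group.IsSolvable G] (hσ : IsPrimePartition σ) (hG : IsMSigmaTGroup σ G) :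
    ResidualConditions σ G := by
  induction hn : Nat.card G using Nat.strong_induction_on generalizing G with
  | _ n ih =>
  subst hn
  cases subsingleton_or_nontrivial G
  · have hsub : ∀ a b : G, Commute a b := fun a b => Subsingleton.elim _ _
    refine ⟨fun a _ b _ => hsub a b, ?_, ?_, fun E _ => ?_, fun _ _ _ _ _ _ _ x d _ _ _ => hsub x d⟩
    · change (Nat.card _).Coprime _
      rw [Nat.card_of_subsingleton (1 : sigmaResidual σ G)]
      exact Nat.coprime_one_left _
    · rw [Nat.card_of_subsingleton (1 : sigmaResidual σ G)]
      exact odd_one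
    · rw [Subsingleton.elim E ⊤]; infer_instance
  obtain ⟨p, hp, hpd, hmax⟩ := exists_max_prime_dvd_card G
  have := Fact.mk hp
  obtain ⟨S⟩ : Nonempty (Sylow p G) := inferInstance
  have hPn : (S : Subgroup G).Normal := hG.sylow_normal_of_max_prime hmax S
  have hP : IsPGroup p (S : Subgroup G) := S.isPGroup'
  have hidx : ¬ p ∣ (S : Subgroup G).index := S.not_dvd_index
  obtain ⟨P, hPS⟩ : ∃ P : Subgroup G, P = S := ⟨_, rfl⟩
  rw [← hPS] at hPn hP hidx
  have hPb : P ≠ ⊥ := by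
    rintro rfl
    rw [Subgroup.index_bot] at hidx
    exact hidx hpd
  obtain ⟨i, hpi⟩ := exists_mem_block hσ hp
  have hR : ∀ N : Subgroup G, ∀ _ : N.Normal, N ≠ ⊥ → ResidualConditions σ (G ⧸ N) :=
    fun N _ hNb => ih _ (card_quotient_lt hNb)
      (hG.of_surjective (QuotientGroup.mk'_surjective N)) rfl
  have hab : ∀ q : ℕ, q.Prime → q ≠ p → ∀ y : G, IsPElement q y → (¬ ∀ u ∈ P, Commute y u) →
      ∀ u ∈ P, ∀ v ∈ P, Commute u v := fun q hq hqp y hy hyP u hu v hv =>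
    hG.commute_of_not_centralizing hp hq hqp.symm hP hy hyP hu hv
  by_cases hout : ∀ q : ℕ, q.Prime → q ∉ σ i → ∀ x : G, IsPElement q x → ∀ u ∈ P, Commute x u
  · refine residualConditions_of_inf_eq_bot hσ hp hP hidx (hR P hPn hPb)
      (sigmaResidual_inf_eq_bot hσ hp hpi hP hidx ?_ hout)
    -- A p'-element of DP moving P would make P abelian with all subgroups normal in G; then D and
    -- P, hence DP, centralise P.
    intro q hq hqp x hx hxq
    by_contra hxP
    have hab' := hab q hq hqp x hxq hxP
    have hn' : ∀ E ≤ P, E.Normal := fun E hE => hG.normal_of_le_sylow hp hP hidx hab' hE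
    refine hxP fun u hu => ?_
    obtain ⟨d, hd, v, hv, rfl⟩ := Subgroup.mem_sup_of_normal_right.1 hx
    exact (sigmaResidual_commute_of_forall_normal hσ hn' hd hu).mul_left (hab' v hv u hu)
  · push Not at hout
    obtain ⟨t, ht, hti, y, hy, u, hu, hyu⟩ := hout
    have hyP : ¬ ∀ u ∈ P, Commute y u := fun h => hyu (h u hu)
    have htp : t ≠ p := by rintro rfl; exact hti hpi
    have hab' := hab t ht htp y hy hyP
    have hn' : ∀ E ≤ P, E.Normal := fun E hE => hG.normal_of_le_sylow hp hP hidx hab' hE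
    have hPD := hG.le_sigmaResidual hσ hp ht hpi hti hP hy hyP
    refine residualConditions_of_le hσ hp hpi ?_ hP hidx hn' hPD ?_ (hR P hPn hPb)
    -- Oddness: t is a prime divisor of |G| other than p, and p is the largest, so p > 2.
    · have htG : t ∣ Nat.card G := by
        rw [← Subgroup.card_top]
        refine hy.dvd_card ht ?_ (Subgroup.mem_top y)
        rintro rfl
        exact hyP fun u _ => Commute.one_left u
      have := hmax t ht htG
      have := ht.two_le
      omega
    · intro q hq hqi x hx
      exact hG.commute_of_block hσ hp hq ht hpi hqi hti hP hidx hab' hn' hPD hR hy hyP hx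

/-! ### Assembling the structure of soluble `MσT`-groups -/

/-- The Hall σ_i-subgroup is K × E, with K the σ_i-part of the σ-nilpotent group M and E =
O_{σ_i}(D); they commute by `commute_block`. If q in σ_i divides |D|, all q-elements lie in E;
otherwise q divides neither the index of M nor that of K in M. -/
theorem ResidualConditions.exists_hall [Finite G] (hR : ResidualConditions σ G) {M : Subgroup G}
    (hM : (sigmaResidual σ G).IsComplement' M) (hMc : SigmaCommuting σ M) (i : ι) :
    ∃ H : Subgroup G, IsHallPiSubgroup (σ i) H ∧
      HasNormalComplementIn ((piCore (σ i) (sigmaResidual σ G)).map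
        (sigmaResidual σ G).subtype) H := by
  set D := sigmaResidual σ G with hD
  set E := (piCore (σ i) D).map D.subtype with hE
  have hED : E ≤ D := Subgroup.map_subtype_le _
  have hEn : E.Normal := hR.normal_of_le E hED
  set K := (piClosure (σ i) M).map M.subtype with hK
  have hKM : K ≤ M := Subgroup.map_subtype_le _
  have hDcomm : ∀ a b : D, Commute a b := fun a b =>
    Subtype.ext (hR.comm a a.2 b b.2).eq
  have hEpi : IsPiGroup (σ i) E := by
    have h1 : piCore (σ i) D ≤ piClosure (σ i) D := by
      refine sSup_le fun N hN => le_of_forall_isPElement fun q hq x hx hxq => ?_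
      by_cases hqi : q ∈ σ i
      · exact hxq.mem_piClosure hq hqi
      · rw [isPiGroup_subgroup_iff.1 hN.2 q hq hqi x hx hxq]; exact Subgroup.one_mem _
    have h2 := isPiGroup_piClosure (G := D) (π := σ i) fun _ _ _ _ _ _ x y _ _ => hDcomm x y
    intro q hq hd
    rw [hE, Subgroup.card_map_of_injective D.subtype_injective] at hd
    exact h2 q hq (hd.trans (Subgroup.card_dvd_of_le h1))
  have hKpi : IsPiGroup (σ i) K := by
    intro q hq hd
    rw [hK, Subgroup.card_map_of_injective M.subtype_injective] at hd
    exact isPiGroup_piClosure (hMc i) q hq hd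
  have hEmem : ∀ q : ℕ, q.Prime → q ∈ σ i → ∀ d ∈ D, IsPElement q d → d ∈ E :=
    fun q hq hqi d hd hdq => hdq.mem_map_piCore hq hqi hR.comm hd
  have hcomm : ∀ m ∈ K, ∀ e ∈ E, Commute m e := by
    have hle : K ≤ Subgroup.centralizer (E : Set G) := by
      rw [hK, Subgroup.map_le_iff_le_comap]
      refine (Subgroup.closure_le _).2 ?_
      rintro m ⟨p, hp, hpi, hm⟩
      have hle : E ≤ Subgroup.centralizer {(m : G)} := by
        refine le_of_forall_isPElement fun q hq e he heq => ?_
        rw [Subgroup.mem_centralizer_singleton_iff]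
        by_cases hqi : q ∈ σ i
        · exact (hR.commute_block i p q hp hq hpi hqi _ e (hED he) (hm.map M.subtype) heq).symm
        · rw [isPiGroup_subgroup_iff.1 hEpi q hq hqi e he heq]; simp
      exact fun e he => Subgroup.mem_centralizer_singleton_iff.1 (hle he)
    exact fun m hm e he => (Subgroup.mem_centralizer_iff.1 (hle hm) e he).symm
  refine ⟨K ⊔ E, ⟨fun q hq hd => ?_, fun q hq hd hqi => ?_⟩, le_sup_right,
    K.subgroupOf (K ⊔ E), ?_, ?_⟩
  · rcases (Nat.Prime.dvd_mul hq).1 (hd.trans (card_sup_dvd_mul K E)) with h | h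
    · exact hEpi q hq h
    · exact hKpi q hq h
  · by_cases hqD : q ∣ Nat.card D
    · refine not_dvd_index_of_forall_isPElement hq (H := K ⊔ E) (fun x hx => ?_) hd
      refine Subgroup.mem_sup_right (hEmem q hq hqi x (hx.mem_of_index hq D fun h => ?_) hx)
      exact Nat.not_coprime_of_dvd_of_dvd hq.one_lt hqD h hR.hall
    · have h1 := hd.trans (Subgroup.index_dvd_of_le (le_sup_left : K ≤ K ⊔ E))
      rw [← Subgroup.relIndex_mul_index hKM, Nat.Prime.dvd_mul hq] at h1
      rcases h1 with h1 | h1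
      · have h2 : K.relIndex M = (piClosure (σ i) M).index := by
          rw [Subgroup.relIndex, hK, Subgroup.subgroupOf,
            Subgroup.comap_map_eq_self_of_injective M.subtype_injective]
        rw [h2] at h1
        exact not_dvd_index_of_forall_isPElement hq (fun x hx => hx.mem_piClosure hq hqi) h1
      · rw [hM.index_eq_card] at h1
        exact hqD h1
  · rw [Subgroup.normal_subgroupOf_iff le_sup_left]
    intro m h hm hh
    obtain ⟨k, hk, e, he, rfl⟩ := Subgroup.mem_sup_of_normal_right.1 hh
    have : k * e * m * (k * e)⁻¹ = k * m * k⁻¹ := by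
      rw [mul_assoc k e m, ← (hcomm m hm e he).eq]; group
    rw [this]
    exact K.mul_mem (K.mul_mem hk hm) (K.inv_mem hk)
  · refine Subgroup.isComplement'_of_disjoint_and_mul_eq_univ ?_ ?_
    · rw [Subgroup.disjoint_def]
      intro x hx1 hx2
      refine Subtype.ext (Subgroup.mem_bot.1 ?_)
      rw [← disjoint_iff.1 hM.disjoint]
      exact ⟨hED hx1, hKM hx2⟩
    · rw [Set.eq_univ_iff_forall]
      rintro ⟨h, hh⟩
      obtain ⟨k, hk, e, he, rfl⟩ := Subgroup.mem_sup_of_normal_right.1 hh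
      exact ⟨⟨e, Subgroup.mem_sup_right he⟩, he, ⟨k, Subgroup.mem_sup_left hk⟩, hk,
        Subtype.ext (hcomm k hk e he).eq.symm⟩

/-- All subgroups of a σ-nilpotent group are σ-subnormal, so the MσT-property becomes transitivity
of modularity. -/
theorem IsMSigmaTGroup.isModularLattice_of_isSigmaNilpotent [Finite G] [Group.IsSolvable G]
    (hσ : IsPrimePartition σ) (hG : IsMSigmaTGroup σ G) (hnil : SigmaCommuting σ G) :
    IsModularLattice (Subgroup G) := by
  refine ModularTransitive.isModularLattice fun K H hH hK => ?_
  exact (hG K H ⟨(hnil.of_injective K.subtype_injective).isSigmaSubnormal hσ H, hH⟩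
    ⟨hnil.isSigmaSubnormal hσ K, hK⟩).2

theorem IsMSigmaTGroup.exists_structureConditions [Finite G] [Group.IsSolvable G]
    (hσ : IsPrimePartition σ) (hG : IsMSigmaTGroup σ G) :
    ∃ M : Subgroup G, StructureConditions σ (sigmaResidual σ G) M := by
  have hR : ResidualConditions σ G := hG.residualConditions hσ
  obtain ⟨M, hM⟩ := Subgroup.exists_right_complement'_of_coprime (N := sigmaResidual σ G) hR.hall
  have hsurj := QuotientGroup.mk'_surjective (sigmaResidual σ G)
  have hinj : Function.Injective ((QuotientGroup.mk' (sigmaResidual σ G)).comp M.subtype) := by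
    rw [injective_iff_map_eq_one]
    intro m hm
    refine Subtype.ext (Subgroup.mem_bot.1 ?_)
    rw [← disjoint_iff.1 hM.disjoint]
    exact ⟨(QuotientGroup.eq_one_iff (m : G)).1 hm, m.2⟩
  have hnil : SigmaCommuting σ (G ⧸ sigmaResidual σ G) :=
    (isSigmaNilpotent_iff hσ).1 (isSigmaNilpotent_quotient_sigmaResidual hσ)
  have hMc : SigmaCommuting σ M := hnil.of_injective hinj
  refine ⟨M, ⟨sigmaResidual_normal, hM, ⟨⟨fun a b => Subtype.ext (hR.comm a a.2 b b.2).eq⟩⟩,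
    hR.hall, hR.odd, (isSigmaNilpotent_iff hσ).2 hMc,
    isModularLattice_of_injective
      ((hG.of_surjective hsurj).isModularLattice_of_isSigmaNilpotent hσ hnil) hinj,
    fun g H => ?_, hR.exists_hall hM hMc⟩⟩
  -- Normality of every subgroup of D in G gives one inclusion; injectivity of conjugation and
  -- finiteness give equality.
  refine Subgroup.eq_of_le_of_card_ge ?_
    (Subgroup.card_map_of_injective (MulEquiv.injective _)).ge
  rintro _ ⟨d, hd, rfl⟩
  obtain ⟨e, he, hed⟩ := (hR.normal_of_le (H.map (sigmaResidual σ G).subtype)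
    (Subgroup.map_subtype_le _)).conj_mem d (Subgroup.mem_map_of_mem _ hd) g
  have : (MulAut.conjNormal g : MulAut (sigmaResidual σ G)) d = e :=
    Subtype.ext (by rw [MulAut.conjNormal_apply]; exact hed.symm)
  change (MulAut.conjNormal g : MulAut (sigmaResidual σ G)) d ∈ H
  rw [this]
  exact he

end Induction
end SigmaGroup

theorem theorem4p5 {G : Type*} [Group G] [Finite G] {ι : Type*} (σ : ι → Set ℕ)
    (hσ : SigmaGroup.IsPrimePartition σ) :
    (Group.IsSolvable G → SigmaGroup.IsMSigmaTGroup σ G →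
      ∃ M : Subgroup G, SigmaGroup.StructureConditions σ (SigmaGroup.sigmaResidual σ G) M) ∧
    (∀ D M : Subgroup G, SigmaGroup.StructureConditions σ D M →
      Group.IsSolvable G ∧ SigmaGroup.IsMSigmaTGroup σ G) :=
  ⟨fun _ hG => hG.exists_structureConditions hσ, fun _ _ S => ⟨S.isSolvable, S.isMSigmaTGroup⟩⟩
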